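/- Let $0<\kappa<1$ and $C>0$. Let $W^\uparrow$ and $\widetilde W^\uparrow$ be two independent copies of the Brownian motion with drift $-\kappa/2$ Doob-conditioned to stay positive, that is, of the continuous process started at $0$, positive on $(0,\infty)$, with generator $\frac12\frac{d^2}{dx^2}+\frac{\kappa}{2}\coth\left(\frac{\kappa}{2}x\right)\frac{d}{dx}$, and let $$\mathcal R_\kappa:=\int_0^\infty e^{-W^\uparrow(x)}\,dx+\int_0^\infty e^{-\widetilde W^\uparrow(x)}\,dx .$$ Let $\nu$ be the measure on $(0,\infty)^2$ such that, for all $x,y>0$, $$\nu\big([x,\infty)\times[y,\infty)\big)=\frac{C}{y^\kappa}\,\mathbb E\left[\mathcal R_\kappa^\kappa\,\mathbf 1_{\mathcal R_\kappa\le y/x}\right]+\frac{C}{x^\kappa}\,\mathbb P\left(\mathcal R_\kappa>\frac yx\right).$$ Let $(\mathcal Y_1,\mathcal Y_2)$ be a càdlàg two-dimensional Lévy process started at $0$ with values in $[0,\infty)^2$ which is a pure jump process (at each time it is the sum of its past jumps) with Lévy measure $\nu$. For a càdlàg function $f:[0,\infty)\to\mathbb R$ put $\Delta f(r):=f(r)-f(r^-)$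 (with $\Delta f(0):=0$), $$f^\natural(s):=\sup_{0\le r\le s}\Delta f(r),\qquad f^{-1}(a):=\inf\{x\ge 0: f(x)>a\},$$ and write $T:=\mathcal Y_2^{-1}(1)$. Define $$F^*:=\inf\left\{s\in(0,T):\ \Delta\mathcal Y_1(s)=\mathcal Y_1^\natural(T^-)\right\},\qquad \mathcal I_1:=\mathcal Y_1^\natural(T^-),\qquad \mathcal I_2:=\big(1-\mathcal Y_2(T^-)\big)\,\frac{\mathcal Y_1(T)-\mathcal Y_1(T^-)}{\mathcal Y_2(T)-\mathcal Y_2(T^-)} .$$ Then the random variable $F^*/T$ is uniformly distributed on $[0,1]$ and is independent of the pair $(\mathcal I_1,\mathcal I_2)$. -/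

import Mathlib

open MeasureTheory ProbabilityTheory Filter Topology
open scoped NNReal ENNReal

noncomputable section

namespace StableJump

/-! ### Functionals of càdlàg paths -/

/-- `f : [0, ∞) → E` is càdlàg: right-continuous with left limits (at `0` the existence of a left
limit is void, since `𝓝[<] 0 = ⊥`). -/
def IsCadlag {E : Type*} [TopologicalSpace E] (f : ℝ≥0 → E) : Prop :=
  ∀ t, ContinuousWithinAt f (Set.Ici t) t ∧ ∃ l, Tendsto f (𝓝[<] t) (𝓝 l)

/-- The jump `Δf(t) = f(t) - f(t⁻)`; in particular `Δf(0) = 0`. -/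
def jump {E : Type*} [TopologicalSpace E] [Sub E] (f : ℝ≥0 → E) (t : ℝ≥0) : E :=
  f t - Function.leftLim f t

/-- `f^♮(s) = sup_{0 ≤ r ≤ s} (f(r) - f(r⁻))`, the largest jump of `f` up to time `s`. -/
def largestJump (f : ℝ≥0 → ℝ) (s : ℝ≥0) : ℝ :=
  sSup (jump f '' Set.Iic s)

/-- `f⁻¹(a) = inf {x ≥ 0 : f(x) > a}`. -/
def firstAbove (f : ℝ≥0 → ℝ) (a : ℝ) : ℝ≥0 :=
  sInf {x | a < f x}

/-- `F*(f₁, f₂) = inf {s ∈ (0, f₂⁻¹(1)) : Δf₁(s) = f₁^♮(f₂⁻¹(1)⁻)}`. -/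
def Fstar (f₁ f₂ : ℝ≥0 → ℝ) : ℝ≥0 :=
  sInf {s | s ∈ Set.Ioo 0 (firstAbove f₂ 1) ∧
    jump f₁ s = Function.leftLim (largestJump f₁) (firstAbove f₂ 1)}

/-- `f₁^♮(f₂⁻¹(1)⁻)`, the largest jump of `f₁` strictly before `f₂⁻¹(1)`. -/
def I₁ (f₁ f₂ : ℝ≥0 → ℝ) : ℝ :=
  Function.leftLim (largestJump f₁) (firstAbove f₂ 1)

/-- `(1 - f₂(T⁻)) (f₁(T) - f₁(T⁻)) / (f₂(T) - f₂(T⁻))` with `T = f₂⁻¹(1)`. -/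
def I₂ (f₁ f₂ : ℝ≥0 → ℝ) : ℝ :=
  (1 - Function.leftLim f₂ (firstAbove f₂ 1)) *
    (jump f₁ (firstAbove f₂ 1) / jump f₂ (firstAbove f₂ 1))

/-! ### The variable `R_κ` -/

/-- The drift `(κ/2) coth(κ x / 2)`. -/
def besselDrift (κ x : ℝ) : ℝ :=
  κ / 2 * (Real.cosh (κ / 2 * x) / Real.sinh (κ / 2 * x))

/-- `W` is the Brownian motion with drift `-κ/2` Doob-conditioned to stay positive, i.e. the
`3`-dimensional `(κ/2)`-drifted Bessel process started at `0`: the continuous process, positive on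
`(0, ∞)`, with generator `(1/2) d²/dx² + (κ/2) coth(κ x / 2) d/dx`, given as the solution of
`dW = dB + (κ/2) coth(κ W / 2) ds`, `W(0) = 0`, with `B` a standard Brownian motion. -/
structure IsConditionedBM {Ω : Type*} [MeasurableSpace Ω] (κ : ℝ) (W : ℝ≥0 → Ω → ℝ)
    (P : Measure Ω) : Prop where
  measurable : ∀ t, Measurable (W t)
  continuous : ∀ ω, Continuous (W · ω)
  zero : ∀ᵐ ω ∂P, W 0 ω = 0
  pos : ∀ᵐ ω ∂P, ∀ t, 0 < t → 0 < W t ω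
  integrable : ∀ᵐ ω ∂P, ∀ t : ℝ≥0,
    IntervalIntegrable (fun s : ℝ ↦ besselDrift κ (W s.toNNReal ω)) volume 0 t
  brownian : IsBrownianReal
    (fun (t : ℝ≥0) ω ↦ W t ω - ∫ s in (0 : ℝ)..t, besselDrift κ (W s.toNNReal ω)) P

/-- `∫₀^∞ e^{-W(x)} dx + ∫₀^∞ e^{-W'(x)} dx`, as an element of `[0, ∞]`. -/
def expFunctional {Ω : Type*} (W W' : ℝ≥0 → Ω → ℝ) (ω : Ω) : ℝ≥0∞ :=
  (∫⁻ x in Set.Ioi (0 : ℝ), ENNReal.ofReal (Real.exp (-W x.toNNReal ω))) +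
    ∫⁻ x in Set.Ioi (0 : ℝ), ENNReal.ofReal (Real.exp (-W' x.toNNReal ω))

/-! ### The Lévy process -/

/-- `ν` is the measure on `(0, ∞)²` with
`ν([x, ∞) × [y, ∞)) = C y^{-κ} E[R^κ 1_{R ≤ y/x}] + C x^{-κ} P(R > y/x)` for `x, y > 0`. -/
structure IsStableMeasure {Ω : Type*} [MeasurableSpace Ω] (κ C : ℝ) (R : Ω → ℝ≥0∞)
    (P : Measure Ω) (ν : Measure (ℝ × ℝ)) : Prop where
  compl : ν (Set.Ioi 0 ×ˢ Set.Ioi 0)ᶜ = 0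
  quadrant : ∀ x y : ℝ, 0 < x → 0 < y →
    ν (Set.Ici x ×ˢ Set.Ici y) =
      ENNReal.ofReal (C / y ^ κ) * (∫⁻ ω in {ω | R ω ≤ ENNReal.ofReal (y / x)}, R ω ^ κ ∂P) +
      ENNReal.ofReal (C / x ^ κ) * P {ω | ENNReal.ofReal (y / x) < R ω}

/-- A Lévy process in a topological group `E`, with all its paths càdlàg. -/
structure IsLevyProcess {Ω E : Type*} [MeasurableSpace Ω] [TopologicalSpace E] [AddGroup E]
    [MeasurableSpace E] (Y : ℝ≥0 → Ω → E) (P : Measure Ω) : Prop where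
  measurable : ∀ t, Measurable (Y t)
  cadlag : ∀ ω, IsCadlag (Y · ω)
  zero : ∀ᵐ ω ∂P, Y 0 ω = 0
  indep : HasIndepIncrements Y P
  stationary : ∀ s h, IdentDistrib (fun ω ↦ Y (s + h) ω - Y s ω) (Y h) P P

/-- `ν` is the Lévy measure of `Y`: for every Borel set `A` that does not contain `0`, `ν(A)` is
the expected number of jumps of `Y` in the time interval `(0, 1]` whose size lies in `A`. -/
def IsLevyMeasure {Ω E : Type*} [MeasurableSpace Ω] [TopologicalSpace E] [AddGroup E]
    [MeasurableSpace E] (ν : Measure E) (Y : ℝ≥0 → Ω → E) (P : Measure Ω) : Prop :=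
  ∀ A : Set E, MeasurableSet A → (0 : E) ∉ A →
    ν A = ∫⁻ ω, ({s : ℝ≥0 | s ∈ Set.Ioc 0 1 ∧ jump (Y · ω) s ∈ A}.encard : ℝ≥0∞) ∂P

/-- `Y` is a pure jump process: almost surely, at every time it is the sum of its past jumps. -/
def IsPureJump {Ω E : Type*} [MeasurableSpace Ω] [TopologicalSpace E] [AddCommGroup E]
    (Y : ℝ≥0 → Ω → E) (P : Measure Ω) : Prop :=
  ∀ᵐ ω ∂P, ∀ t : ℝ≥0, HasSum (fun s : Set.Iic t ↦ jump (Y · ω) s) (Y t ω)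

end StableJump

end

/-! Sample the process on a grid of mesh `δ`. The increments of the pair are i.i.d., hence
exchangeable. The index `k` of the block in which the second coordinate crosses level 1 depends only
on partial sums, which are unchanged when two of the first `k` increments are exchanged. Such an
exchange also preserves the value of the largest first coordinate among these `k` increments, the
sum before the crossing and the crossing increment; it only moves the position `j` of the maximum.
So, given these data, `j` is uniform on `{0, ..., k - 1}` (`lintegral_atCrossingMax_eq_average`).

As `δ → 0`, `(j + 1) / k` tends to `F*/T`, the discrete data tend to the largest jump before `T`,
the level `Y₂(T⁻)` and the two jumps at `T` (`exists_grid_approx`), and averages of a continuous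
function over `(j + 1) / k` tend to its integral over `[0, 1]`. Dominated convergence then gives the
product law of `F*/T` and the data, of which `(I₁, I₂)` is a measurable function.

The limit needs almost sure properties of the paths: both coordinates nondecreasing, `Y₂` exceeding
1, `Y₁` jumping immediately, and no two positive jumps of `Y₁` of equal size, so that the maximal
jump exists and is unique. The last two come from the first marginal of `ν`, whose tail is `C
x^{-κ}`: it is infinite near 0 and has no atoms. Since the Lévy measure enters only through expected
numbers of jumps, these properties are derived by comparing jumps with independent grid increments
(`IsLevyMeasure.ae_exists_jump`, `IsLevyMeasure.ae_jump_injective`). Finally, the grids are chosen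
so that `T` almost surely never falls on them. -/

noncomputable section

namespace StableJump

/-! ### Increments of nondecreasing right-continuous functions -/

/-- The increment of `f` over the `j`-th interval `(jδ, (j+1)δ]` of the grid of mesh `δ`. -/
def gridIncr {E : Type*} [Sub E] (f : ℝ≥0 → E) (δ : ℝ≥0) (j : ℕ) : E :=
  f ((j + 1 : ℕ) * δ) - f (j * δ)

section Path

variable {f : ℝ≥0 → ℝ}

lemma nhdsLT_neBot {s : ℝ≥0} (hs : 0 < s) : (𝓝[<] s).NeBot :=
  nhdsLT_neBot_of_exists_lt ⟨0, hs⟩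

lemma jump_nonneg (hf : Monotone f) (s : ℝ≥0) : 0 ≤ jump f s :=
  sub_nonneg.2 (hf.leftLim_le le_rfl)

lemma jump_le_sub (hf : Monotone f) {l s r : ℝ≥0} (hl : l < s) (hr : s ≤ r) :
    jump f s ≤ f r - f l :=
  sub_le_sub (hf hr) (hf.le_leftLim hl)

lemma jump_zero (f : ℝ≥0 → ℝ) : jump f 0 = 0 := by
  rw [jump, leftLim_eq_of_isBot (fun _ ↦ zero_le), sub_self]

lemma tendsto_leftLim_comp {ι : Type*} {F : Filter ι} (hf : Monotone f) {l : ι → ℝ≥0} {s : ℝ≥0}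
    (hl : Tendsto l F (𝓝 s)) (hls : ∀ᶠ i in F, l i < s) :
    Tendsto (fun i ↦ f (l i)) F (𝓝 (Function.leftLim f s)) :=
  (hf.tendsto_leftLim s).comp (tendsto_nhdsWithin_iff.2 ⟨hl, hls⟩)

lemma tendsto_right_comp {ι : Type*} {F : Filter ι} {s : ℝ≥0}
    (hf : ContinuousWithinAt f (Set.Ici s) s) {r : ι → ℝ≥0}
    (hr : Tendsto r F (𝓝 s)) (hsr : ∀ᶠ i in F, s ≤ r i) :
    Tendsto (fun i ↦ f (r i)) F (𝓝 (f s)) :=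
  Tendsto.comp hf (tendsto_nhdsWithin_iff.2 ⟨hr, hsr⟩)

lemma tendsto_sub_jump {ι : Type*} {F : Filter ι} (hf : Monotone f) {s : ℝ≥0}
    (hc : ContinuousWithinAt f (Set.Ici s) s) {l r : ι → ℝ≥0}
    (hl : Tendsto l F (𝓝 s)) (hr : Tendsto r F (𝓝 s))
    (hls : ∀ᶠ i in F, l i < s) (hsr : ∀ᶠ i in F, s ≤ r i) :
    Tendsto (fun i ↦ f (r i) - f (l i)) F (𝓝 (jump f s)) :=
  (tendsto_right_comp hc hr hsr).sub (tendsto_leftLim_comp hf hl hls)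

/-- Intervals that shrink to `s` and carry an increment bounded below must contain `s`. -/
lemma eventually_mem_Ioc_of_le_sub {ι : Type*} {F : Filter ι} (hf : Monotone f) {s : ℝ≥0}
    (hc : ContinuousWithinAt f (Set.Ici s) s) {l r : ι → ℝ≥0} {a : ℝ} (ha : 0 < a)
    (hlr : ∀ i, l i ≤ r i) (hl : Tendsto l F (𝓝 s)) (hr : Tendsto r F (𝓝 s))
    (hinc : ∀ i, a ≤ f (r i) - f (l i)) :
    ∀ᶠ i in F, l i < s ∧ s ≤ r i := by
  -- If `S` were met frequently while both endpoint values had the same limit along it, the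
  -- increments would tend to 0 there, against the bound `a`. This rules out intervals lying to the
  -- right of `s` (common limit `f s`) and to its left (common limit `f(s⁻)`).
  have key : ∀ {S : Set ι} {c : ℝ}, Tendsto (fun i ↦ f (r i)) (F ⊓ 𝓟 S) (𝓝 c) →
      Tendsto (fun i ↦ f (l i)) (F ⊓ 𝓟 S) (𝓝 c) → ∀ᶠ i in F, i ∉ S := by
    intro S c h1 h2
    by_contra hS
    have hne : (F ⊓ 𝓟 S).NeBot := by
      rw [Filter.not_eventually] at hS
      simpa using (frequently_mem_iff_neBot (s := S)).1 (by simpa using hS)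
    have := ge_of_tendsto (h1.sub h2) (Eventually.of_forall hinc)
    linarith [sub_self c]
  have h1 : ∀ᶠ i in F, i ∉ {i | s ≤ l i} := by
    have hm : ∀ᶠ i in F ⊓ 𝓟 {i | s ≤ l i}, s ≤ l i := mem_inf_of_right (mem_principal_self _)
    exact key (tendsto_right_comp hc (hr.mono_left inf_le_left)
      (hm.mono fun i hi ↦ hi.trans (hlr i)))
      (tendsto_right_comp hc (hl.mono_left inf_le_left) hm)
  have h2 : ∀ᶠ i in F, i ∉ {i | r i < s} := by
    have hm : ∀ᶠ i in F ⊓ 𝓟 {i | r i < s}, r i < s := mem_inf_of_right (mem_principal_self _)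
    exact key (tendsto_leftLim_comp hf (hr.mono_left inf_le_left) hm)
      (tendsto_leftLim_comp hf (hl.mono_left inf_le_left)
        (hm.mono fun i hi ↦ (hlr i).trans_lt hi))
  filter_upwards [h1, h2] with i hi hi'
  simp only [not_le, not_lt] at hi hi'
  exact ⟨hi, hi'⟩

/-- Shrinking intervals carrying increments bounded below accumulate at a jump. -/
lemma exists_jump_of_le_sub (hf : Monotone f) (hc : ∀ s, ContinuousWithinAt f (Set.Ici s) s)
    {l r ε : ℕ → ℝ≥0} {a : ℝ} {c : ℝ≥0} (ha : 0 < a) (hlr : ∀ n, l n ≤ r n)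
    (hε : Tendsto ε atTop (𝓝 0)) (hrl : ∀ n, r n ≤ l n + ε n) (hrc : ∀ n, r n ≤ c)
    (hinc : ∀ n, a ≤ f (r n) - f (l n)) :
    ∃ s, ∃ φ : ℕ → ℕ, StrictMono φ ∧ (∀ m, l (φ m) < s ∧ s ≤ r (φ m)) ∧
      Tendsto (fun m ↦ f (r (φ m)) - f (l (φ m))) atTop (𝓝 (jump f s)) := by
  obtain ⟨s, -, φ, hφ, hφs⟩ := (isCompact_Icc (a := (0 : ℝ≥0)) (b := c)).tendsto_subseq
    (x := l) (fun n ↦ ⟨zero_le, (hlr n).trans (hrc n)⟩)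
  have hr : Tendsto (r ∘ φ) atTop (𝓝 s) := by
    refine tendsto_of_tendsto_of_tendsto_of_le_of_le hφs
      (h := fun m ↦ l (φ m) + ε (φ m)) ?_ (fun m ↦ hlr _) (fun m ↦ hrl _)
    simpa using hφs.add (hε.comp hφ.tendsto_atTop)
  have hev := eventually_mem_Ioc_of_le_sub hf (hc s) ha (fun m ↦ hlr (φ m)) hφs hr
    (fun m ↦ hinc (φ m))
  obtain ⟨N, hN⟩ := eventually_atTop.1 hev
  have hlim := tendsto_sub_jump hf (hc s) hφs hr (hev.mono fun _ h ↦ h.1) (hev.mono fun _ h ↦ h.2)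
  exact ⟨s, fun m ↦ φ (m + N), fun x y hxy ↦ hφ (by omega), fun m ↦ hN _ (by omega),
    hlim.comp (tendsto_add_atTop_nat N)⟩

/-- Along a maximising sequence of times, short intervals ending at these times carry increments of
at least half the supremum, so they accumulate at a jump, which attains the supremum. Its time
belongs to one of these intervals, hence lies strictly before `T`. -/
lemma exists_isMax_jump (hf : Monotone f) (hc : ∀ s, ContinuousWithinAt f (Set.Ici s) s)
    {T s₀ : ℝ≥0} (hs₀ : s₀ ∈ Set.Ioo 0 T) (hpos : 0 < jump f s₀) :
    ∃ s ∈ Set.Ioo 0 T, 0 < jump f s ∧ ∀ t ∈ Set.Ioo 0 T, jump f t ≤ jump f s := by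
  set V := jump f '' Set.Ioo 0 T with hV
  have hbdd : BddAbove V := by
    refine ⟨f T - f 0, ?_⟩
    rintro _ ⟨t, ht, rfl⟩
    exact jump_le_sub hf ht.1 ht.2.le
  have hne : V.Nonempty := ⟨_, s₀, hs₀, rfl⟩
  have hle : jump f s₀ ≤ sSup V := le_csSup hbdd ⟨s₀, hs₀, rfl⟩
  obtain ⟨u, -, hu, huV⟩ := exists_seq_tendsto_sSup hne hbdd
  choose t ht htu using huV
  obtain ⟨N, hN⟩ := eventually_atTop.1
    (hu.eventually_const_le (show sSup V / 2 < sSup V by linarith))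
  have hl : ∀ n : ℕ, ∃ l, l < t (n + N) ∧ t (n + N) ≤ l + 1 / ((n : ℝ≥0) + 1) := by
    intro n
    refine ⟨t (n + N) - 1 / ((n : ℝ≥0) + 1), tsub_lt_self (ht _).1 (by positivity), ?_⟩
    exact le_tsub_add
  choose l hlt hlt' using hl
  obtain ⟨s, φ, hφ, hmem, hlim⟩ := exists_jump_of_le_sub hf hc (l := l) (r := fun n ↦ t (n + N))
    (c := T) (a := sSup V / 2) (by linarith) (fun n ↦ (hlt n).le)
    tendsto_one_div_add_atTop_nhds_zero_nat hlt' (fun n ↦ (ht _).2.le) (fun n ↦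
      ((hN (n + N) (by omega)).trans_eq (htu _).symm).trans (jump_le_sub hf (hlt n) le_rfl))
  have hmax : sSup V ≤ jump f s := by
    refine le_of_tendsto_of_tendsto' (hu.comp ((tendsto_add_atTop_nat N).comp hφ.tendsto_atTop))
      hlim fun m ↦ ?_
    simp only [Function.comp_apply]
    rw [← htu]
    exact jump_le_sub hf (hlt _) le_rfl
  refine ⟨s, ⟨zero_le.trans_lt (hmem 0).1, (hmem 0).2.trans_lt (ht _).2⟩, by linarith,
    fun t' ht' ↦ (le_csSup hbdd ⟨t', ht', rfl⟩).trans hmax⟩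

/-! ### First passage above level one -/

lemma one_lt_of_firstAbove_lt (hf : Monotone f) (hex : ∃ x, 1 < f x) {x : ℝ≥0}
    (hx : firstAbove f 1 < x) : 1 < f x := by
  obtain ⟨y, hy, hyx⟩ := exists_lt_of_csInf_lt (s := {x | 1 < f x}) hex hx
  exact lt_of_lt_of_le hy (hf hyx.le)

lemma firstAbove_pos (hf : Monotone f) (hc : ContinuousWithinAt f (Set.Ici 0) 0)
    (h0 : f 0 = 0) (hex : ∃ x, 1 < f x) : 0 < firstAbove f 1 := by
  have h1 : ∀ᶠ x in 𝓝[>] (0 : ℝ≥0), f x < 1 :=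
    (hc.mono Set.Ioi_subset_Ici_self).eventually_lt_const (by simp [h0])
  obtain ⟨x, hx, hx0⟩ := (h1.and self_mem_nhdsWithin).exists
  refine lt_of_lt_of_le (Set.mem_Ioi.1 hx0) (not_lt.1 fun h ↦ ?_)
  exact hx.not_gt (one_lt_of_firstAbove_lt hf hex h)

lemma firstAbove_mem_Icc (hf : Monotone f) {l r : ℝ≥0} (hl : f l ≤ 1) (hr : 1 < f r) :
    firstAbove f 1 ∈ Set.Icc l r :=
  ⟨not_lt.1 fun h ↦ (one_lt_of_firstAbove_lt hf ⟨r, hr⟩ h).not_ge hl,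
    csInf_le (s := {x | 1 < f x}) (OrderBot.bddBelow _) hr⟩

lemma exists_grid_crossing (h0 : f 0 = 0) (hf : Monotone f) (hex : ∃ x, 1 < f x) {δ : ℝ≥0}
    (hδ : 0 < δ) : ∃ k : ℕ, f (k * δ) ≤ 1 ∧ 1 < f ((k + 1 : ℕ) * δ) := by
  classical
  have hex' : ∃ k : ℕ, 1 < f (k * δ) := by
    obtain ⟨x, hx⟩ := hex
    obtain ⟨k, hk⟩ := exists_nat_ge (x / δ)
    exact ⟨k, hx.trans_le (hf ((div_le_iff₀ hδ).1 hk))⟩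
  obtain ⟨k, hk⟩ : ∃ k, Nat.find hex' = k + 1 := by
    refine Nat.exists_eq_succ_of_ne_zero fun h ↦ ?_
    have := Nat.find_spec hex'
    rw [h] at this
    norm_num [h0] at this
  exact ⟨k, not_lt.1 (Nat.find_min hex' (by omega)), hk ▸ Nat.find_spec hex'⟩

lemma exists_grid_block {δ s : ℝ≥0} (hδ : 0 < δ) (hs : 0 < s) :
    ∃ j : ℕ, j * δ < s ∧ s ≤ (j + 1 : ℕ) * δ := by
  obtain ⟨j, hj⟩ : ∃ j, ⌈s / δ⌉₊ = j + 1 :=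
    Nat.exists_eq_succ_of_ne_zero (Nat.ceil_pos.2 (div_pos hs hδ)).ne'
  refine ⟨j, (lt_div_iff₀ hδ).1 (Nat.lt_ceil.1 (by omega)), ?_⟩
  rw [← hj]
  exact (div_le_iff₀ hδ).1 (Nat.le_ceil _)

lemma grid_block_unique {δ s : ℝ≥0} {i j : ℕ} (hi : i * δ < s ∧ s ≤ (i + 1 : ℕ) * δ)
    (hj : j * δ < s ∧ s ≤ (j + 1 : ℕ) * δ) : i = j := by
  have h1 : (i : ℝ≥0) < (j + 1 : ℕ) := lt_of_mul_lt_mul_right (hi.1.trans_le hj.2) zero_le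
  have h2 : (j : ℝ≥0) < (i + 1 : ℕ) := lt_of_mul_lt_mul_right (hj.1.trans_le hi.2) zero_le
  norm_cast at h1 h2
  omega

/-- The endpoints of grid intervals containing `s` converge to `s` as the mesh goes to zero. -/
lemma tendsto_grid_endpoints {ι : Type*} {F : Filter ι} {δ : ι → ℝ≥0} {j : ι → ℕ} {s : ℝ≥0}
    (hδ : Tendsto δ F (𝓝 0))
    (hj : ∀ i, j i * δ i ≤ s ∧ s ≤ (j i + 1 : ℕ) * δ i) :
    Tendsto (fun i ↦ j i * δ i) F (𝓝 s) ∧ Tendsto (fun i ↦ (j i + 1 : ℕ) * δ i) F (𝓝 s) := by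
  have e : ∀ i, ((j i + 1 : ℕ) : ℝ≥0) * δ i = j i * δ i + δ i := fun i ↦ by push_cast; ring
  constructor
  · refine tendsto_of_tendsto_of_tendsto_of_le_of_le (g := fun i ↦ s - δ i) (h := fun _ ↦ s) ?_
      tendsto_const_nhds (fun i ↦ ?_) (fun i ↦ (hj i).1)
    · simpa using tendsto_const_nhds.sub hδ
    · exact tsub_le_iff_right.2 (e i ▸ (hj i).2)
  · refine tendsto_of_tendsto_of_tendsto_of_le_of_le (g := fun _ ↦ s) (h := fun i ↦ s + δ i)
      tendsto_const_nhds ?_ (fun i ↦ (hj i).2) (fun i ↦ ?_)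
    · simpa using tendsto_const_nhds.add hδ
    · simp only [e]
      gcongr
      exact (hj i).1

end Path

/-! ### Convergence of the discretised functionals along a path -/

section Path

variable {f f₁ f₂ : ℝ≥0 → ℝ}

/-- The `j`-th of the first `k` terms of `d` is strictly larger than the others. -/
def IsStrictMax (d : ℕ → ℝ) (k j : ℕ) : Prop :=
  j < k ∧ ∀ i < k, i ≠ j → d i < d j

lemma largestJump_eq {T s : ℝ≥0} (hf : Monotone f)
    (hmax : ∀ t ∈ Set.Ioo 0 T, jump f t ≤ jump f s) {r : ℝ≥0} (hr : r ∈ Set.Ico s T) :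
    largestJump f r = jump f s := by
  refine IsGreatest.csSup_eq ⟨⟨s, hr.1, rfl⟩, ?_⟩
  rintro _ ⟨t, ht, rfl⟩
  rcases eq_or_lt_of_le (zero_le (a := t)) with rfl | h0
  · rw [jump_zero]
    exact jump_nonneg hf s
  · exact hmax t ⟨h0, lt_of_le_of_lt ht hr.2⟩

lemma I₁_eq {s : ℝ≥0} (hf : Monotone f₁) (hs : s ∈ Set.Ioo 0 (firstAbove f₂ 1))
    (hmax : ∀ t ∈ Set.Ioo 0 (firstAbove f₂ 1), jump f₁ t ≤ jump f₁ s) :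
    I₁ f₁ f₂ = jump f₁ s := by
  have := nhdsLT_neBot (hs.1.trans hs.2)
  refine leftLim_eq_of_tendsto (tendsto_const_nhds.congr' ?_)
  filter_upwards [Ico_mem_nhdsLT hs.2] with r hr
  exact (largestJump_eq hf hmax hr).symm

lemma Fstar_eq {s : ℝ≥0} (hf : Monotone f₁) (hs : s ∈ Set.Ioo 0 (firstAbove f₂ 1))
    (hmax : ∀ t ∈ Set.Ioo 0 (firstAbove f₂ 1), jump f₁ t ≤ jump f₁ s)
    (huniq : ∀ t ∈ Set.Ioo 0 (firstAbove f₂ 1), jump f₁ t = jump f₁ s → t = s) :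
    Fstar f₁ f₂ = s := by
  have : {t | t ∈ Set.Ioo 0 (firstAbove f₂ 1) ∧
      jump f₁ t = Function.leftLim (largestJump f₁) (firstAbove f₂ 1)} = {s} := by
    rw [show Function.leftLim (largestJump f₁) (firstAbove f₂ 1) = jump f₁ s from I₁_eq hf hs hmax]
    ext t
    exact ⟨fun h ↦ huniq t h.1 h.2, fun h ↦ by rw [Set.mem_singleton_iff.1 h]; exact ⟨hs, rfl⟩⟩
  rw [Fstar, this, csInf_singleton]

/-- The index of the largest grid increment before the crossing time localises the largest jump. -/
lemma eventually_isStrictMax (hf : Monotone f) (hc : ∀ s, ContinuousWithinAt f (Set.Ici s) s)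
    {T s : ℝ≥0} (hs : s ∈ Set.Ioo 0 T) (hpos : 0 < jump f s)
    (huniq : ∀ t ∈ Set.Ioo 0 T, jump f s ≤ jump f t → t = s)
    {δ : ℕ → ℝ≥0} (hδ : Tendsto δ atTop (𝓝 0))
    {k j : ℕ → ℕ} (hk : ∀ n, k n * δ n < T ∧ T ≤ (k n + 1 : ℕ) * δ n)
    (hj : ∀ n, j n * δ n < s ∧ s ≤ (j n + 1 : ℕ) * δ n) :
    ∀ᶠ n in atTop, IsStrictMax (gridIncr f (δ n)) (k n) (j n) := by
  have hkT := (tendsto_grid_endpoints hδ fun n ↦ ⟨(hk n).1.le, (hk n).2⟩).1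
  have hjk : ∀ᶠ n in atTop, j n < k n := by
    filter_upwards [hkT.eventually_const_lt hs.2] with n hn
    have : (j n : ℝ≥0) < k n := lt_of_mul_lt_mul_right ((hj n).1.trans hn) zero_le
    exact_mod_cast this
  by_contra hcon
  have hfreq := (Filter.not_eventually.1 hcon).and_eventually hjk
  -- Otherwise a rival block does at least as well on arbitrarily fine grids. The rivals end before
  -- `T` and accumulate at a jump no smaller than the one at `s`, hence at `s` itself; but then the
  -- rival block and block `j` both contain `s`, so they coincide.
  have hfreq' : ∃ᶠ n in atTop, ∃ i, i < k n ∧ i ≠ j n ∧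
      gridIncr f (δ n) (j n) ≤ gridIncr f (δ n) i := by
    refine hfreq.mono fun n hn ↦ ?_
    by_contra! h
    exact hn.1 ⟨hn.2, h⟩
  obtain ⟨ψ, hψ, hψ'⟩ := extraction_of_frequently_atTop hfreq'
  choose i hik hij hi using hψ'
  have hiT : ∀ m, ((i m + 1 : ℕ) : ℝ≥0) * δ (ψ m) < T := fun m ↦
    lt_of_le_of_lt (by gcongr; exact hik m) (hk (ψ m)).1
  obtain ⟨t, φ, hφ, hmem, hlim⟩ := exists_jump_of_le_sub hf hc
    (l := fun m ↦ i m * δ (ψ m)) (r := fun m ↦ (i m + 1 : ℕ) * δ (ψ m)) (ε := δ ∘ ψ) (c := T)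
    hpos (fun m ↦ by gcongr; omega) (hδ.comp hψ.tendsto_atTop)
    (fun m ↦ by simp only [Function.comp_apply]; push_cast; rw [add_mul, one_mul])
    (fun m ↦ (hiT m).le)
    (fun m ↦ (jump_le_sub hf (hj (ψ m)).1 (hj (ψ m)).2).trans (hi m))
  have hle : jump f s ≤ jump f t := ge_of_tendsto' hlim fun m ↦
    (jump_le_sub hf (hj (ψ (φ m))).1 (hj (ψ (φ m))).2).trans (hi (φ m))
  have hts : t = s := huniq t ⟨zero_le.trans_lt (hmem 0).1, (hmem 0).2.trans_lt (hiT _)⟩ hle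
  subst hts
  exact hij (φ 0) (grid_block_unique (hmem 0) (hj _))

/-- Along a nondecreasing path whose jumps are pairwise distinct, the functionals of the path
stopped at its first passage above `1` are limits of functionals of grid increments. -/
theorem exists_grid_approx (hf₁ : Monotone f₁) (hf₂ : Monotone f₂)
    (hc₁ : ∀ s, ContinuousWithinAt f₁ (Set.Ici s) s)
    (hc₂ : ∀ s, ContinuousWithinAt f₂ (Set.Ici s) s)
    (h0 : f₂ 0 = 0) (hex : ∃ x, 1 < f₂ x)
    (hjump : ∃ s ∈ Set.Ioo 0 (firstAbove f₂ 1), 0 < jump f₁ s)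
    (hties : ∀ s t, 0 < jump f₁ s → jump f₁ s = jump f₁ t → s = t)
    {δ : ℕ → ℝ≥0} (hδ₀ : ∀ n, 0 < δ n) (hδ : Tendsto δ atTop (𝓝 0))
    (hT : ∀ n (k : ℕ), firstAbove f₂ 1 ≠ k * δ n) :
    ∃ k j : ℕ → ℕ,
      (∀ n, f₂ (k n * δ n) ≤ 1 ∧ 1 < f₂ ((k n + 1 : ℕ) * δ n)) ∧
      (∀ᶠ n in atTop, IsStrictMax (gridIncr f₁ (δ n)) (k n) (j n)) ∧
      Tendsto k atTop atTop ∧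
      Tendsto (fun n ↦ ((j n + 1 : ℕ) : ℝ) / k n) atTop
        (𝓝 ((Fstar f₁ f₂ : ℝ) / firstAbove f₂ 1)) ∧
      Tendsto (fun n ↦ gridIncr f₁ (δ n) (j n)) atTop (𝓝 (I₁ f₁ f₂)) ∧
      Tendsto (fun n ↦ f₂ (k n * δ n)) atTop (𝓝 (Function.leftLim f₂ (firstAbove f₂ 1))) ∧
      Tendsto (fun n ↦ gridIncr f₁ (δ n) (k n)) atTop (𝓝 (jump f₁ (firstAbove f₂ 1))) ∧
      Tendsto (fun n ↦ gridIncr f₂ (δ n) (k n)) atTop (𝓝 (jump f₂ (firstAbove f₂ 1))) := by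
  obtain ⟨s₀, hs₀, hpos₀⟩ := hjump
  obtain ⟨s, hs, hpos, hmax⟩ := exists_isMax_jump hf₁ hc₁ hs₀ hpos₀
  set T := firstAbove f₂ 1 with hTdef
  choose k hk using fun n ↦ exists_grid_crossing h0 hf₂ hex (hδ₀ n)
  choose j hj using fun n ↦ exists_grid_block (hδ₀ n) hs.1
  -- Strictness on the left, supplied by `hT`, is what makes `f₂ (k n * δ n)` converge to the left
  -- limit at `T` rather than to `f₂ T`.
  have hkT : ∀ n, k n * δ n < T ∧ T ≤ (k n + 1 : ℕ) * δ n := fun n ↦ by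
    have := firstAbove_mem_Icc hf₂ (hk n).1 (hk n).2
    exact ⟨lt_of_le_of_ne this.1 (hT n (k n)).symm, this.2⟩
  have huniq : ∀ t ∈ Set.Ioo 0 T, jump f₁ t = jump f₁ s → t = s := fun t _ h ↦
    (hties s t hpos h.symm).symm
  have huniq' : ∀ t ∈ Set.Ioo 0 T, jump f₁ s ≤ jump f₁ t → t = s := fun t ht h ↦
    huniq t ht ((hmax t ht).antisymm h)
  obtain ⟨hkl, hkr⟩ := tendsto_grid_endpoints hδ fun n ↦ ⟨(hkT n).1.le, (hkT n).2⟩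
  obtain ⟨hjl, hjr⟩ := tendsto_grid_endpoints hδ fun n ↦ ⟨(hj n).1.le, (hj n).2⟩
  have hT0 : 0 < T := hs.1.trans hs.2
  refine ⟨k, j, hk, eventually_isStrictMax hf₁ hc₁ hs hpos huniq' hδ hkT hj, ?_, ?_, ?_,
    tendsto_leftLim_comp hf₂ hkl (Eventually.of_forall fun n ↦ (hkT n).1), ?_, ?_⟩
  · refine tendsto_atTop.2 fun N ↦ ?_
    have h1 : Tendsto (fun n ↦ (N : ℝ≥0) * δ n) atTop (𝓝 0) := by
      simpa using tendsto_const_nhds.mul hδ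
    filter_upwards [h1.eventually_lt hkl hT0] with n hn
    have : (N : ℝ≥0) < k n := lt_of_mul_lt_mul_right hn zero_le
    exact_mod_cast this.le
  · rw [Fstar_eq hf₁ hs hmax huniq]
    have h1 : Tendsto (fun n ↦ ((((j n + 1 : ℕ) : ℝ≥0) * δ n : ℝ≥0) : ℝ) /
        (((k n : ℝ≥0) * δ n : ℝ≥0) : ℝ)) atTop (𝓝 ((s : ℝ) / T)) :=
      (NNReal.tendsto_coe.2 hjr).div (NNReal.tendsto_coe.2 hkl) (by exact_mod_cast hT0.ne')
    refine h1.congr fun n ↦ ?_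
    have : (δ n : ℝ) ≠ 0 := by exact_mod_cast (hδ₀ n).ne'
    push_cast
    rw [mul_div_mul_right _ _ this]
  · rw [I₁_eq hf₁ hs hmax]
    exact tendsto_sub_jump hf₁ (hc₁ s) hjl hjr (Eventually.of_forall fun n ↦ (hj n).1)
      (Eventually.of_forall fun n ↦ (hj n).2)
  · exact tendsto_sub_jump hf₁ (hc₁ T) hkl hkr (Eventually.of_forall fun n ↦ (hkT n).1)
      (Eventually.of_forall fun n ↦ (hkT n).2)
  · exact tendsto_sub_jump hf₂ (hc₂ T) hkl hkr (Eventually.of_forall fun n ↦ (hkT n).1)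
      (Eventually.of_forall fun n ↦ (hkT n).2)

end Path

/-! ### The first marginal of the Lévy measure -/

lemma lintegral_exp_neg_pos {w : ℝ≥0 → ℝ} (hw : Continuous w) :
    0 < ∫⁻ x in Set.Ioi (0 : ℝ), ENNReal.ofReal (Real.exp (-w x.toNNReal)) := by
  have hm : Measurable fun x : ℝ ↦ ENNReal.ofReal (Real.exp (-w x.toNNReal)) := by
    have := (hw.comp continuous_real_toNNReal).measurable
    simp only [Function.comp_def] at this
    fun_prop
  rw [lintegral_pos_iff_support hm]
  have : Function.support (fun x : ℝ ↦ ENNReal.ofReal (Real.exp (-w x.toNNReal))) = Set.univ := by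
    ext x
    simp [Real.exp_pos]
  simp [this]

section Marginal

variable {Ω : Type*} [MeasurableSpace Ω]

lemma measurable_lintegral_exp_neg {W : ℝ≥0 → Ω → ℝ} (hm : ∀ t, Measurable (W t))
    (hc : ∀ ω, Continuous (W · ω)) :
    Measurable fun ω ↦ ∫⁻ x in Set.Ioi (0 : ℝ), ENNReal.ofReal (Real.exp (-W x.toNNReal ω)) := by
  have h : Measurable (Function.uncurry W) :=
    measurable_uncurry_of_continuous_of_measurable (u := W) hc hm
  have h' : Measurable fun p : Ω × ℝ ↦ W p.2.toNNReal p.1 :=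
    h.comp ((measurable_real_toNNReal.comp measurable_snd).prodMk measurable_fst)
  exact Measurable.lintegral_prod_right' (f := fun p : Ω × ℝ ↦
    ENNReal.ofReal (Real.exp (-W p.2.toNNReal p.1))) (by fun_prop)

/-- Let `y → 0` in the quadrant formula. On `{R ≤ y/x}` the integrand is at most `(y/x)^κ`, so the
first term is at most `C x^{-κ} P(R ≤ y/x)` and the total at most `C x^{-κ}`. The second term alone
tends to `C x^{-κ}`, because `R > 0`. -/
lemma IsStableMeasure.marginal {κ C : ℝ} (hκ : 0 < κ) (hC : 0 < C) {R : Ω → ℝ≥0∞}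
    {P : Measure Ω} [IsProbabilityMeasure P] (hR : Measurable R) (hpos : ∀ ω, 0 < R ω)
    {ν : Measure (ℝ × ℝ)} (hν : IsStableMeasure κ C R P ν) {x : ℝ} (hx : 0 < x) :
    ν (Set.Ici x ×ˢ Set.univ) = ENNReal.ofReal (C / x ^ κ) := by
  set y : ℕ → ℝ := fun n ↦ 1 / ((n : ℝ) + 1) with hy
  have hy0 : ∀ n, 0 < y n := fun n ↦ by positivity
  have hylim : Tendsto y atTop (𝓝 0) := tendsto_one_div_add_atTop_nhds_zero_nat
  have hunion : ν (Set.Ici x ×ˢ Set.univ) = ν (⋃ n, Set.Ici x ×ˢ Set.Ici (y n)) := by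
    refine measure_congr ?_
    have h0 : ∀ᵐ p ∂ν, p ∈ Set.Ioi (0 : ℝ) ×ˢ Set.Ioi (0 : ℝ) := mem_ae_iff.2 hν.compl
    filter_upwards [h0] with p hp
    obtain ⟨n, hn⟩ := exists_nat_one_div_lt (show 0 < p.2 from hp.2)
    refine propext ⟨fun h ↦ Set.mem_iUnion.2 ⟨n, h.1, hn.le⟩, fun h ↦ ?_⟩
    obtain ⟨m, hm⟩ := Set.mem_iUnion.1 h
    exact ⟨hm.1, trivial⟩
  have hmono : Monotone fun n ↦ Set.Ici x ×ˢ Set.Ici (y n) := fun m n hmn ↦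
    Set.prod_mono le_rfl (Set.Ici_subset_Ici.2 (one_div_le_one_div_of_le (by positivity)
      (by gcongr)))
  have hlim : Tendsto (fun n ↦ ν (Set.Ici x ×ˢ Set.Ici (y n))) atTop
      (𝓝 (ν (Set.Ici x ×ˢ Set.univ))) := by
    rw [hunion]
    exact tendsto_measure_iUnion_atTop hmono
  set c := ENNReal.ofReal (C / x ^ κ) with hc
  have hcx : ∀ n, ENNReal.ofReal (C / y n ^ κ) * ENNReal.ofReal (y n / x) ^ κ = c := fun n ↦ by
    have h1 : 0 < y n ^ κ := Real.rpow_pos_of_pos (hy0 n) _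
    rw [ENNReal.ofReal_rpow_of_pos (div_pos (hy0 n) hx), ← ENNReal.ofReal_mul (by positivity),
      Real.div_rpow (hy0 n).le hx.le, hc]
    congr 1
    field_simp
  have hmeas : ∀ n, MeasurableSet {ω | R ω ≤ ENNReal.ofReal (y n / x)} := fun n ↦
    measurableSet_le hR measurable_const
  have hcompl : ∀ n, {ω | ENNReal.ofReal (y n / x) < R ω} =
      {ω | R ω ≤ ENNReal.ofReal (y n / x)}ᶜ := fun n ↦ by ext; simp
  have hupper : ∀ n, ν (Set.Ici x ×ˢ Set.Ici (y n)) ≤ c := fun n ↦ by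
    rw [hν.quadrant x (y n) hx (hy0 n), hcompl]
    calc _ ≤ ENNReal.ofReal (C / y n ^ κ) *
          (∫⁻ ω in {ω | R ω ≤ ENNReal.ofReal (y n / x)}, ENNReal.ofReal (y n / x) ^ κ ∂P) +
          c * P {ω | R ω ≤ ENNReal.ofReal (y n / x)}ᶜ := by
            gcongr _ * ?_ + _
            refine setLIntegral_mono' (hmeas n) fun ω hω ↦ ?_
            exact ENNReal.rpow_le_rpow hω hκ.le
      _ = c * (P {ω | R ω ≤ ENNReal.ofReal (y n / x)} +
            P {ω | R ω ≤ ENNReal.ofReal (y n / x)}ᶜ) := by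
            rw [setLIntegral_const, ← mul_assoc, hcx, mul_add]
      _ = c := by rw [measure_add_measure_compl (hmeas n), measure_univ, mul_one]
  have hlower : ∀ n, c * P {ω | ENNReal.ofReal (y n / x) < R ω} ≤
      ν (Set.Ici x ×ˢ Set.Ici (y n)) := fun n ↦ by
    rw [hν.quadrant x (y n) hx (hy0 n)]
    exact le_add_self
  have hPlim : Tendsto (fun n ↦ P {ω | ENNReal.ofReal (y n / x) < R ω}) atTop (𝓝 1) := by
    have hu : (⋃ n, {ω | ENNReal.ofReal (y n / x) < R ω}) = Set.univ := by
      refine Set.eq_univ_of_forall fun ω ↦ Set.mem_iUnion.2 ?_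
      have : Tendsto (fun n ↦ ENNReal.ofReal (y n / x)) atTop (𝓝 0) := by
        simpa using ENNReal.tendsto_ofReal (hylim.div_const x)
      exact (this.eventually_lt_const (hpos ω)).exists
    have := tendsto_measure_iUnion_atTop (μ := P)
      (s := fun n ↦ {ω | ENNReal.ofReal (y n / x) < R ω}) (fun m n hmn ω hω ↦
        lt_of_le_of_lt (ENNReal.ofReal_le_ofReal (div_le_div_of_nonneg_right
          (one_div_le_one_div_of_le (by positivity) (by gcongr)) hx.le)) hω)
    rwa [hu, measure_univ] at this
  refine le_antisymm (le_of_tendsto' hlim hupper) ?_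
  refine le_of_tendsto_of_tendsto' ?_ hlim hlower
  simpa using ENNReal.Tendsto.const_mul hPlim (Or.inr ENNReal.ofReal_ne_top)

end Marginal

/-! ### Paths of nonnegative Lévy processes -/

section Levy

variable {Ω : Type*} [MeasurableSpace Ω] {P : Measure Ω}

lemma IsCadlag.fst {E F : Type*} [TopologicalSpace E] [TopologicalSpace F] {f : ℝ≥0 → E × F}
    (hf : IsCadlag f) : IsCadlag fun t ↦ (f t).1 := fun t ↦
  ⟨(hf t).1.fst, (hf t).2.choose.1, (continuous_fst.tendsto _).comp (hf t).2.choose_spec⟩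

lemma IsCadlag.snd {E F : Type*} [TopologicalSpace E] [TopologicalSpace F] {f : ℝ≥0 → E × F}
    (hf : IsCadlag f) : IsCadlag fun t ↦ (f t).2 := fun t ↦
  ⟨(hf t).1.snd, (hf t).2.choose.2, (continuous_snd.tendsto _).comp (hf t).2.choose_spec⟩

/-- `leftLim` has a default value where no left limit exists, so splitting it into coordinates
relies on the path being càdlàg. -/
lemma jump_prodMk {f : ℝ≥0 → ℝ × ℝ} (hf : IsCadlag f) (t : ℝ≥0) :
    jump f t = (jump (fun s ↦ (f s).1) t, jump (fun s ↦ (f s).2) t) := by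
  rcases eq_or_neBot (𝓝[<] t) with h | h
  · simp only [jump, leftLim_eq_of_eq_bot _ h]
    rfl
  · obtain ⟨l, hl⟩ := (hf t).2
    rw [jump, jump, jump, leftLim_eq_of_tendsto hl,
      leftLim_eq_of_tendsto (f := fun s ↦ (f s).1) ((continuous_fst.tendsto _).comp hl),
      leftLim_eq_of_tendsto (f := fun s ↦ (f s).2) ((continuous_snd.tendsto _).comp hl)]
    rfl

lemma IsLevyProcess.fst {Y : ℝ≥0 → Ω → ℝ × ℝ} (hY : IsLevyProcess Y P) :
    IsLevyProcess (fun t ω ↦ (Y t ω).1) P where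
  measurable t := (hY.measurable t).fst
  cadlag ω := (hY.cadlag ω).fst
  zero := hY.zero.mono fun ω h ↦ by simp [h]
  indep := hY.indep.map' (f := AddMonoidHom.fst ℝ ℝ) measurable_fst
  stationary s h := (hY.stationary s h).comp measurable_fst

lemma IsLevyProcess.snd {Y : ℝ≥0 → Ω → ℝ × ℝ} (hY : IsLevyProcess Y P) :
    IsLevyProcess (fun t ω ↦ (Y t ω).2) P where
  measurable t := (hY.measurable t).snd
  cadlag ω := (hY.cadlag ω).snd
  zero := hY.zero.mono fun ω h ↦ by simp [h]
  indep := hY.indep.map' (f := AddMonoidHom.snd ℝ ℝ) measurable_snd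
  stationary s h := (hY.stationary s h).comp measurable_snd

lemma IsLevyMeasure.map_fst {Y : ℝ≥0 → Ω → ℝ × ℝ} (hY : IsLevyProcess Y P)
    {ν : Measure (ℝ × ℝ)} (hν : IsLevyMeasure ν Y P) :
    IsLevyMeasure (ν.map Prod.fst) (fun t ω ↦ (Y t ω).1) P := fun A hA h0 ↦ by
  rw [Measure.map_apply measurable_fst hA, hν _ (measurable_fst hA) (by simpa using h0)]
  simp only [jump_prodMk (hY.cadlag _), Set.mem_preimage]

lemma IsLevyMeasure.map_snd {Y : ℝ≥0 → Ω → ℝ × ℝ} (hY : IsLevyProcess Y P)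
    {ν : Measure (ℝ × ℝ)} (hν : IsLevyMeasure ν Y P) :
    IsLevyMeasure (ν.map Prod.snd) (fun t ω ↦ (Y t ω).2) P := fun A hA h0 ↦ by
  rw [Measure.map_apply measurable_snd hA, hν _ (measurable_snd hA) (by simpa using h0)]
  simp only [jump_prodMk (hY.cadlag _), Set.mem_preimage]

section Increments

variable {E : Type*} [TopologicalSpace E] [AddGroup E] [MeasurableSpace E]
  {Y : ℝ≥0 → Ω → E}

lemma IsLevyProcess.measurable_gridIncr [MeasurableSub₂ E] (hY : IsLevyProcess Y P) (δ : ℝ≥0) (j : ℕ) :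
    Measurable fun ω ↦ gridIncr (Y · ω) δ j :=
  (hY.measurable _).sub (hY.measurable _)

lemma IsLevyProcess.iIndepFun_gridIncr (hY : IsLevyProcess Y P) (δ : ℝ≥0) :
    iIndepFun (fun j ω ↦ gridIncr (Y · ω) δ j) P :=
  hY.indep.nat (t := fun j : ℕ ↦ j * δ) (fun i j hij ↦ by dsimp only; gcongr)

lemma IsLevyProcess.identDistrib_gridIncr (hY : IsLevyProcess Y P) (δ : ℝ≥0) (j : ℕ) :
    IdentDistrib (fun ω ↦ gridIncr (Y · ω) δ j) (Y δ) P P := by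
  have := hY.stationary (j * δ) δ
  rw [show (j : ℝ≥0) * δ + δ = (j + 1 : ℕ) * δ by push_cast; ring] at this
  exact this

end Increments

variable {X : ℝ≥0 → Ω → ℝ}

lemma IsLevyProcess.measure_gridIncr_mem (hX : IsLevyProcess X P) (δ : ℝ≥0) (j : ℕ) {B : Set ℝ}
    (hB : MeasurableSet B) : P {ω | gridIncr (X · ω) δ j ∈ B} = P {ω | X δ ω ∈ B} :=
  (hX.identDistrib_gridIncr δ j).measure_mem_eq hB

/-- The probability that none of the first `N` grid increments lies in `B`. -/
lemma IsLevyProcess.measure_forall_gridIncr_notMem [IsProbabilityMeasure P]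
    (hX : IsLevyProcess X P) (δ : ℝ≥0) (N : ℕ) {B : Set ℝ} (hB : MeasurableSet B) :
    P {ω | ∀ j < N, gridIncr (X · ω) δ j ∉ B} = (1 - P {ω | X δ ω ∈ B}) ^ N := by
  have h := (hX.iIndepFun_gridIncr δ).measure_inter_preimage_eq_mul (Finset.range N)
    (sets := fun _ ↦ Bᶜ) (fun _ _ ↦ hB.compl)
  have e : (⋂ j ∈ Finset.range N, (fun ω ↦ gridIncr (X · ω) δ j) ⁻¹' Bᶜ) =
      {ω | ∀ j < N, gridIncr (X · ω) δ j ∉ B} := by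
    ext ω; simp
  rw [← e, h]
  have : ∀ j, P ((fun ω ↦ gridIncr (X · ω) δ j) ⁻¹' Bᶜ) = 1 - P {ω | X δ ω ∈ B} := fun j ↦ by
    rw [Set.preimage_compl, prob_compl_eq_one_sub (hX.measurable_gridIncr δ j hB)]
    exact congrArg (1 - ·) (hX.measure_gridIncr_mem δ j hB)
  rw [Finset.prod_congr rfl fun j _ ↦ this j, Finset.prod_const, Finset.card_range]

lemma monotone_of_dense {f : ℝ≥0 → ℝ} (hc : ∀ s, ContinuousWithinAt f (Set.Ici s) s)
    {D : Set ℝ≥0} (hD : Dense D) (h : ∀ s ∈ D, ∀ t ∈ D, s ≤ t → f s ≤ f t) : Monotone f := by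
  have hfreq : ∀ s, ∃ᶠ t in 𝓝[>] s, t ∈ D := fun s ↦ by
    refine (frequently_iff).2 fun {U} hU ↦ ?_
    obtain ⟨u, hu, hsub⟩ := mem_nhdsGT_iff_exists_Ioo_subset.1 hU
    obtain ⟨x, hx, hxD⟩ := hD.exists_mem_open isOpen_Ioo (Set.nonempty_Ioo.2 hu)
    exact ⟨x, hsub hxD, hx⟩
  have hlim : ∀ s, Tendsto f (𝓝[>] s) (𝓝 (f s)) := fun s ↦ (hc s).mono Set.Ioi_subset_Ici_self
  intro s t hst
  refine ge_of_tendsto_of_frequently (hlim t)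
    (((hfreq t).and_eventually self_mem_nhdsWithin).mono ?_)
  rintro r ⟨hr, htr⟩
  refine le_of_tendsto_of_frequently (hlim s) (((hfreq s).and_eventually
    (Ioo_mem_nhdsGT (hst.trans_lt htr))).mono ?_)
  rintro q ⟨hq, hqr⟩
  exact h q hq r hr hqr.2.le

/-- An increment over `(s, t]` has the law of `X (t - s)`, so it is almost surely nonnegative. A
countable dense set of times and right-continuity make the exceptional event independent of `s` and
`t`. -/
lemma IsLevyProcess.ae_monotone (hX : IsLevyProcess X P) (hnn : ∀ᵐ ω ∂P, ∀ t, 0 ≤ X t ω) :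
    ∀ᵐ ω ∂P, Monotone (X · ω) := by
  obtain ⟨D, hDc, hD⟩ := TopologicalSpace.exists_countable_dense ℝ≥0
  have h : ∀ s t, ∀ᵐ ω ∂P, s ≤ t → X s ω ≤ X t ω := fun s t ↦ by
    by_cases hst : s ≤ t
    · have h0 : ∀ᵐ ω ∂P, X (t - s) ω ∈ Set.Ici 0 := hnn.mono fun ω h ↦ h _
      have := (hX.stationary s (t - s)).symm.ae_mem_snd measurableSet_Ici h0
      rw [add_tsub_cancel_of_le hst] at this
      filter_upwards [this] with ω hω _
      exact sub_nonneg.1 hω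
    · exact Eventually.of_forall fun ω h ↦ absurd h hst
  have h' : ∀ᵐ ω ∂P, ∀ s ∈ D, ∀ t ∈ D, s ≤ t → X s ω ≤ X t ω :=
    (ae_ball_iff hDc).2 fun s _ ↦ (ae_ball_iff hDc).2 fun t _ ↦ h s t
  filter_upwards [h'] with ω hω
  exact monotone_of_dense (fun s ↦ (hX.cadlag ω s).1) hD hω

/-- A nonnegative Lévy process that is not identically zero is unbounded. -/
lemma IsLevyProcess.ae_exists_one_lt [IsProbabilityMeasure P] (hX : IsLevyProcess X P)
    (hnn : ∀ᵐ ω ∂P, ∀ t, 0 ≤ X t ω) (hne : P {ω | 0 < X 1 ω} ≠ 0) :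
    ∀ᵐ ω ∂P, ∃ x, 1 < X x ω := by
  obtain ⟨n, hn⟩ : ∃ n : ℕ, P {ω | X 1 ω ∈ Set.Ici (1 / ((n : ℝ) + 1))} ≠ 0 := by
    by_contra! h
    refine hne (measure_mono_null (fun ω hω ↦ ?_) (measure_iUnion_null h))
    obtain ⟨n, hn⟩ := exists_nat_one_div_lt (show 0 < X 1 ω from hω)
    exact Set.mem_iUnion.2 ⟨n, hn.le⟩
  set ε : ℝ := 1 / ((n : ℝ) + 1) with hε
  have hε0 : 0 < ε := by positivity
  set s : ℕ → Set Ω := fun j ↦ {ω | gridIncr (X · ω) 1 j ∈ Set.Ici ε} with hs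
  have hsm : ∀ j, MeasurableSet (s j) := fun j ↦ hX.measurable_gridIncr 1 j measurableSet_Ici
  have hind : iIndepSet s P := (iIndepSet_iff_meas_biInter hsm).2 fun F ↦
    (hX.iIndepFun_gridIncr 1).measure_inter_preimage_eq_mul F (sets := fun _ ↦ Set.Ici ε)
      (fun _ _ ↦ measurableSet_Ici)
  -- By the second Borel–Cantelli lemma, infinitely many unit-time increments are at least `ε`. A
  -- nondecreasing path bounded by 1 would have summable increments.
  have hsum : ∑' j, P (s j) = ⊤ := by
    simp only [hs, hX.measure_gridIncr_mem 1 _ measurableSet_Ici]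
    exact ENNReal.tsum_const_eq_top_of_ne_zero hn
  have hlim := measure_limsup_eq_one hsm hind hsum
  have hae : ∀ᵐ ω ∂P, ω ∈ limsup s atTop :=
    (prob_compl_eq_zero_iff (MeasurableSet.measurableSet_limsup hsm)).2 hlim
  filter_upwards [hae, hX.ae_monotone hnn, hnn] with ω hω hmono h0
  by_contra! hle
  have htel : ∀ N, ∑ j ∈ Finset.range N, gridIncr (X · ω) 1 j = X N ω - X 0 ω := fun N ↦ by
    have := Finset.sum_range_sub (fun j : ℕ ↦ X ((j : ℝ≥0) * 1) ω) N
    simpa [gridIncr] using this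
  have hsummable : Summable (gridIncr (X · ω) 1) :=
    summable_of_sum_range_le (c := 1)
      (fun j ↦ sub_nonneg.2 (hmono (by gcongr; omega))) fun N ↦ by
        rw [htel]
        linarith [hle N, h0 0]
  have hsmall := hsummable.tendsto_atTop_zero.eventually_lt_const hε0
  rw [mem_limsup_iff_frequently_mem] at hω
  obtain ⟨j, hj, hj'⟩ := (hω.and_eventually hsmall).exists
  exact hj'.not_ge hj

/-- A jump in `(0, 1]` of a nondecreasing path is at most `X 1 - X 0`. If `X 1` were almost surely 0
there would be no positive jumps, and their expected number `μ (Ioi 0)` would vanish. -/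
lemma IsLevyMeasure.measure_pos_ne_zero (hX : IsLevyProcess X P)
    (hnn : ∀ᵐ ω ∂P, ∀ t, 0 ≤ X t ω) {μ : Measure ℝ} (hμ : IsLevyMeasure μ X P)
    (hμ0 : μ (Set.Ioi 0) ≠ 0) : P {ω | 0 < X 1 ω} ≠ 0 := by
  intro h
  refine hμ0 ?_
  rw [hμ _ measurableSet_Ioi (by simp)]
  refine lintegral_eq_zero_of_ae_eq_zero ?_
  have h' : ∀ᵐ ω ∂P, ¬ 0 < X 1 ω := by
    rw [ae_iff]
    simpa using h
  filter_upwards [h', hnn, hX.ae_monotone hnn] with ω hω h0 hmono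
  have : {s : ℝ≥0 | s ∈ Set.Ioc 0 1 ∧ jump (X · ω) s ∈ Set.Ioi 0} = ∅ := by
    refine Set.eq_empty_of_forall_notMem fun s hs ↦ ?_
    have h1 := jump_le_sub hmono hs.1.1 hs.1.2
    have h2 : 0 < jump (X · ω) s := hs.2
    linarith [h0 0]
  rw [this, Set.encard_empty]
  simp

end Levy

/-! ### Existence and distinctness of jumps -/

section Path

variable {f : ℝ≥0 → ℝ}

lemma encard_le_of_forall_finset {α : Type*} {S : Set α} {b : ℝ≥0∞}
    (h : ∀ F : Finset α, (F : Set α) ⊆ S → (F.card : ℝ≥0∞) ≤ b) : (S.encard : ℝ≥0∞) ≤ b := by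
  rcases S.finite_or_infinite with hS | hS
  · have := h hS.toFinset (by simp)
    rwa [hS.encard_eq_coe_toFinset_card]
  · have : b = ⊤ := by
      refine ENNReal.eq_top_of_forall_nnreal_le fun r ↦ ?_
      obtain ⟨n, hn⟩ := exists_nat_ge r
      obtain ⟨F, hF, hcard⟩ := hS.exists_subset_card_eq n
      refine le_trans ?_ (h F hF)
      rw [hcard]
      exact_mod_cast hn
    simp [this]

/-- Different points eventually lie in different intervals of the grid. -/
lemma eventually_grid_block_ne {δ : ℕ → ℝ≥0} (hδ : Tendsto δ atTop (𝓝 0)) {s t : ℝ≥0}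
    (hst : s ≠ t) : ∀ᶠ n in atTop, ∀ j : ℕ, j * δ n < s → s ≤ (j + 1 : ℕ) * δ n →
      j * δ n < t → t ≤ (j + 1 : ℕ) * δ n → False := by
  wlog h : s < t generalizing s t
  · filter_upwards [this hst.symm (lt_of_le_of_ne (not_lt.1 h) hst.symm)] with n hn j h1 h2 h3 h4
    exact hn j h3 h4 h1 h2
  filter_upwards [hδ.eventually_lt_const (tsub_pos_of_lt h)] with n hn j h1 h2 h3 h4
  refine hn.not_ge (tsub_le_iff_left.2 ?_)
  push_cast at h4
  rw [add_mul, one_mul] at h4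
  exact h4.trans (by gcongr)

/-- Any finite family of jumps is eventually separated by the grid, and a block's increment is at
least any jump it contains. This is the pathwise bound to which Fatou's lemma is applied. -/
lemma encard_jumps_le_liminf (hf : Monotone f) {x : ℝ} {δ : ℕ → ℝ≥0} (hδ₀ : ∀ n, 0 < δ n)
    (hδ : Tendsto δ atTop (𝓝 0)) {N : ℕ → ℕ} (hN : ∀ n, N n * δ n = 1) :
    ({s : ℝ≥0 | s ∈ Set.Ioc 0 1 ∧ jump f s ∈ Set.Ici x}.encard : ℝ≥0∞) ≤
      liminf (fun n ↦ ∑ j ∈ Finset.range (N n),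
        {j | gridIncr f (δ n) j ∈ Set.Ici x}.indicator (fun _ ↦ (1 : ℝ≥0∞)) j) atTop := by
  classical
  refine encard_le_of_forall_finset fun F hF ↦ le_liminf_of_le (by isBoundedDefault) ?_
  choose! b hb using fun n (s : ℝ≥0) (hs : 0 < s) ↦ exists_grid_block (hδ₀ n) hs
  have hinj : ∀ᶠ n in atTop, Set.InjOn (b n) F := by
    have : ∀ᶠ n in atTop, ∀ s ∈ F, ∀ t ∈ F, s ≠ t → ∀ j : ℕ, j * δ n < s →
        s ≤ (j + 1 : ℕ) * δ n → j * δ n < t → t ≤ (j + 1 : ℕ) * δ n → False := by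
      refine (Finset.eventually_all F).2 fun s hs ↦ (Finset.eventually_all F).2 fun t ht ↦ ?_
      by_cases hst : s = t
      · exact Eventually.of_forall fun n h ↦ absurd hst h
      · exact (eventually_grid_block_ne hδ hst).mono fun n hn _ ↦ hn
    filter_upwards [this] with n hn s hs t ht hbst
    by_contra hst
    have h1 := hb n s (hF hs).1.1
    have h2 := hb n t (hF ht).1.1
    rw [← hbst] at h2
    exact hn s hs t ht hst _ h1.1 h1.2 h2.1 h2.2
  filter_upwards [hinj] with n hn
  have hsub : F.image (b n) ⊆
      (Finset.range (N n)).filter fun j ↦ gridIncr f (δ n) j ∈ Set.Ici x := by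
    intro j hj
    obtain ⟨s, hs, rfl⟩ := Finset.mem_image.1 hj
    have h1 := hb n s (hF hs).1.1
    refine Finset.mem_filter.2 ⟨Finset.mem_range.2 ?_, ?_⟩
    · have : (b n s : ℝ≥0) < N n :=
        lt_of_mul_lt_mul_right (h1.1.trans_le ((hF hs).1.2.trans_eq (hN n).symm)) zero_le
      exact_mod_cast this
    · exact le_trans (hF hs).2 (jump_le_sub hf h1.1 h1.2)
  calc (F.card : ℝ≥0∞) = ((F.image (b n)).card : ℝ≥0∞) := by rw [Finset.card_image_of_injOn hn]
    _ ≤ (((Finset.range (N n)).filter fun j ↦ gridIncr f (δ n) j ∈ Set.Ici x).card : ℝ≥0∞) := by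
        exact_mod_cast Finset.card_le_card hsub
    _ = _ := by
        rw [Finset.card_filter]
        push_cast
        refine Finset.sum_congr rfl fun j _ ↦ ?_
        simp [Set.indicator_apply]

/-- Grid increments in `[a, b)` on arbitrarily fine grids come from a jump in `[a, b]`. -/
lemma exists_jump_of_frequently_gridIncr (hf : Monotone f)
    (hc : ∀ s, ContinuousWithinAt f (Set.Ici s) s) {K : Set ℝ} (hK : IsClosed K) {a : ℝ}
    (ha : 0 < a) (hKa : K ⊆ Set.Ici a) {c : ℝ≥0}
    {δ : ℕ → ℝ≥0} (hδ : Tendsto δ atTop (𝓝 0)) {N : ℕ → ℕ} (hN : ∀ n, N n * δ n ≤ c)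
    (h : ∃ᶠ n in atTop, ∃ j < N n, gridIncr f (δ n) j ∈ K) :
    ∃ s ∈ Set.Ioc 0 c, jump f s ∈ K := by
  obtain ⟨ψ, hψ, hψ'⟩ := extraction_of_frequently_atTop h
  choose i hiN hi using hψ'
  have hic : ∀ m, ((i m + 1 : ℕ) : ℝ≥0) * δ (ψ m) ≤ c := fun m ↦
    le_trans (by gcongr; exact hiN m) (hN (ψ m))
  obtain ⟨s, φ, hφ, hmem, hlim⟩ := exists_jump_of_le_sub hf hc
    (l := fun m ↦ i m * δ (ψ m)) (r := fun m ↦ (i m + 1 : ℕ) * δ (ψ m)) (ε := δ ∘ ψ) (c := c)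
    ha (fun m ↦ by gcongr; omega) (hδ.comp hψ.tendsto_atTop)
    (fun m ↦ by simp only [Function.comp_apply]; push_cast; rw [add_mul, one_mul])
    hic (fun m ↦ hKa (hi m))
  exact ⟨s, ⟨zero_le.trans_lt (hmem 0).1, (hmem 0).2.trans (hic _)⟩,
    hK.mem_of_tendsto hlim (Eventually.of_forall fun m ↦ hi _)⟩

/-- Two jumps of the same size in `[a, b)` are seen as two grid increments in `[a, b)`. -/
lemma eventually_exists_pair_gridIncr (hf : Monotone f)
    (hc : ∀ s, ContinuousWithinAt f (Set.Ici s) s) {a b : ℝ} {c s t : ℝ≥0} (hst : s ≠ t)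
    (hs : s ∈ Set.Ioc 0 c) (ht : t ∈ Set.Ioc 0 c) (hjs : jump f s ∈ Set.Ico a b)
    (hjt : jump f t ∈ Set.Ico a b) {δ : ℕ → ℝ≥0} (hδ₀ : ∀ n, 0 < δ n)
    (hδ : Tendsto δ atTop (𝓝 0)) {N : ℕ → ℕ} (hN : ∀ n, N n * δ n = c) :
    ∀ᶠ n in atTop, ∃ i < N n, ∃ j < N n, i ≠ j ∧ gridIncr f (δ n) i ∈ Set.Ico a b ∧
      gridIncr f (δ n) j ∈ Set.Ico a b := by
  have key : ∀ u ∈ Set.Ioc 0 c, jump f u ∈ Set.Ico a b → ∀ᶠ n in atTop, ∃ i < N n,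
      gridIncr f (δ n) i ∈ Set.Ico a b ∧ i * δ n < u ∧ u ≤ (i + 1 : ℕ) * δ n := by
    intro u hu hju
    choose i hi using fun n ↦ exists_grid_block (hδ₀ n) hu.1
    obtain ⟨hl, hr⟩ := tendsto_grid_endpoints hδ fun n ↦ ⟨(hi n).1.le, (hi n).2⟩
    have hlim := tendsto_sub_jump hf (hc u) hl hr (Eventually.of_forall fun n ↦ (hi n).1)
      (Eventually.of_forall fun n ↦ (hi n).2)
    -- The increment over a block containing `u` is at least the jump and converges to it, so it
    -- eventually enters a bin that is closed on the left and open on the right.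
    filter_upwards [hlim.eventually_lt_const hju.2] with n hn
    have : (i n : ℝ≥0) < N n :=
      lt_of_mul_lt_mul_right ((hi n).1.trans_le (hu.2.trans_eq (hN n).symm)) zero_le
    exact ⟨i n, by exact_mod_cast this,
      ⟨hju.1.trans (jump_le_sub hf (hi n).1 (hi n).2), hn⟩, hi n⟩
  filter_upwards [key s hs hjs, key t ht hjt, eventually_grid_block_ne hδ hst] with n h1 h2 h3
  obtain ⟨i, hiN, hi, hi'⟩ := h1
  obtain ⟨j, hjN, hj, hj'⟩ := h2
  refine ⟨i, hiN, j, hjN, ?_, hi, hj⟩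
  rintro rfl
  exact h3 i hi'.1 hi'.2 hj'.1 hj'.2

end Path

/-! ### From pathwise eventual statements to bounds on probabilities. -/

section Levy

variable {Ω : Type*} [MeasurableSpace Ω] {P : Measure Ω}

/-- Continuity from below for increasing unions needs no measurability, so `G` may be an event about
uncountably many jump times. -/
lemma measure_le_of_eventually_mem {G : Set Ω} {E : ℕ → Set Ω} {b : ℝ≥0∞}
    (hG : ∀ᵐ ω ∂P, ω ∈ G → ∀ᶠ n in atTop, ω ∈ E n) (hE : ∃ᶠ n in atTop, P (E n) ≤ b) :
    P G ≤ b := by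
  have h1 : P G ≤ P (⋃ N, ⋂ n ≥ N, E n) := by
    refine measure_mono_ae (hG.mono fun ω hω hωG ↦ ?_)
    obtain ⟨N, hN⟩ := eventually_atTop.1 (hω hωG)
    exact Set.mem_iUnion.2 ⟨N, Set.mem_iInter₂.2 hN⟩
  have hmono : Monotone fun N ↦ ⋂ n ≥ N, E n := fun M N hMN ↦
    Set.biInter_subset_biInter_left fun n hn ↦ le_trans hMN hn
  refine h1.trans ?_
  rw [hmono.measure_iUnion]
  refine iSup_le fun N ↦ ?_
  obtain ⟨n, hn, hnb⟩ := frequently_atTop.1 hE N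
  exact (measure_mono (Set.biInter_subset_of_mem hn)).trans hnb

/-- If the events `H n` occur infinitely often with probability less than `b`, then eventually each
of them has probability less than `b`. -/
lemma eventually_measure_lt_of_limsup [IsFiniteMeasure P] {H : ℕ → Set Ω}
    (hH : ∀ n, MeasurableSet (H n)) {b : ℝ≥0∞} (hb : P (limsup H atTop) < b) :
    ∀ᶠ n in atTop, P (H n) < b := by
  have hanti : Antitone fun N ↦ ⋃ n ≥ N, H n := fun M N hMN ↦
    Set.biUnion_subset_biUnion_left fun n hn ↦ le_trans hMN hn
  have h := tendsto_measure_iInter_atTop (μ := P) (s := fun N ↦ ⋃ n ≥ N, H n)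
    (fun N ↦ (MeasurableSet.biUnion (Set.to_countable _) fun n _ ↦ hH n).nullMeasurableSet) hanti
    ⟨0, measure_ne_top _ _⟩
  have e : (⋂ N, ⋃ n ≥ N, H n) = limsup H atTop := by
    rw [limsup_eq_iInf_iSup_of_nat]
    simp
  rw [e] at h
  filter_upwards [h.eventually_lt_const hb] with n hn
  exact (measure_mono (Set.subset_iUnion₂ (s := fun m (_ : m ≥ n) ↦ H m) n le_rfl)).trans_lt hn

end Levy

/-! ### Grid increments compared with the Lévy measure. -/

section Levy

variable {Ω : Type*} [MeasurableSpace Ω] {P : Measure Ω} {X : ℝ≥0 → Ω → ℝ} {μ : Measure ℝ}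

/-- Fatou's lemma applied to `encard_jumps_le_liminf`; by stationarity the right-hand side is the
expected number of grid increments of size at least `x`. -/
lemma IsLevyMeasure.eventually_lt_mul (hX : IsLevyProcess X P)
    (hnn : ∀ᵐ ω ∂P, ∀ t, 0 ≤ X t ω) (hμ : IsLevyMeasure μ X P) {x : ℝ} (hx : 0 < x)
    {δ : ℕ → ℝ≥0} (hδ₀ : ∀ n, 0 < δ n) (hδ : Tendsto δ atTop (𝓝 0)) {N : ℕ → ℕ}
    (hN : ∀ n, N n * δ n = 1) {L : ℝ≥0∞} (hL : L < μ (Set.Ici x)) :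
    ∀ᶠ n in atTop, L < N n * P {ω | X (δ n) ω ∈ Set.Ici x} := by
  have hm : ∀ n j, MeasurableSet {ω | gridIncr (X · ω) (δ n) j ∈ Set.Ici x} := fun n j ↦
    hX.measurable_gridIncr (δ n) j measurableSet_Ici
  set c : ℕ → Ω → ℝ≥0∞ := fun n ω ↦ ∑ j ∈ Finset.range (N n),
    {ω | gridIncr (X · ω) (δ n) j ∈ Set.Ici x}.indicator (fun _ ↦ (1 : ℝ≥0∞)) ω with hc
  have hle : μ (Set.Ici x) ≤ liminf (fun n ↦ ∫⁻ ω, c n ω ∂P) atTop := by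
    rw [hμ _ measurableSet_Ici (by simpa using hx)]
    refine le_trans (lintegral_mono_ae ?_) (lintegral_liminf_le fun n ↦
      Finset.measurable_fun_sum _ fun j _ ↦ measurable_const.indicator (hm n j))
    filter_upwards [hX.ae_monotone hnn] with ω hω
    exact encard_jumps_le_liminf hω hδ₀ hδ hN
  have hint : ∀ n, ∫⁻ ω, c n ω ∂P = N n * P {ω | X (δ n) ω ∈ Set.Ici x} := fun n ↦ by
    rw [hc, lintegral_finsetSum _ fun j _ ↦ measurable_const.indicator (hm n j)]
    simp only [lintegral_indicator_const (hm n _), one_mul]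
    rw [Finset.sum_congr rfl fun j _ ↦ hX.measure_gridIncr_mem (δ n) j measurableSet_Ici]
    simp
  simp only [hint] at hle
  exact eventually_lt_of_lt_liminf (hL.trans_le hle)

lemma one_sub_pow_le_exp {p : ℝ≥0∞} (hp : p ≤ 1) (N : ℕ) :
    (1 - p) ^ N ≤ ENNReal.ofReal (Real.exp (-(N * p.toReal))) := by
  have hp' : p ≠ ⊤ := ne_top_of_le_ne_top ENNReal.one_ne_top hp
  have h1 : p.toReal ≤ 1 := ENNReal.toReal_le_of_le_ofReal zero_le_one (by simpa using hp)
  have h2 : 1 - p = ENNReal.ofReal (1 - p.toReal) := by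
    rw [ENNReal.ofReal_sub _ ENNReal.toReal_nonneg, ENNReal.ofReal_toReal hp', ENNReal.ofReal_one]
  rw [h2, ← ENNReal.ofReal_pow (by linarith)]
  refine ENNReal.ofReal_le_ofReal ?_
  calc (1 - p.toReal) ^ N ≤ Real.exp (-p.toReal) ^ N :=
        pow_le_pow_left₀ (by linarith) (Real.one_sub_le_exp_neg _) N
    _ = _ := by rw [← Real.exp_nat_mul]; ring_nf

/-- A nonnegative Lévy process with infinite Lévy measure jumps immediately. -/
lemma IsLevyMeasure.ae_exists_jump [IsProbabilityMeasure P] (hX : IsLevyProcess X P)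
    (hnn : ∀ᵐ ω ∂P, ∀ t, 0 ≤ X t ω) (hμ : IsLevyMeasure μ X P)
    (htop : ∀ L : ℝ≥0, ∃ x > 0, (L : ℝ≥0∞) < μ (Set.Ici x)) :
    ∀ᵐ ω ∂P, ∀ ε > 0, ∃ s ∈ Set.Ioo 0 ε, 0 < jump (X · ω) s := by
  have key : ∀ m : ℕ, ∀ᵐ ω ∂P, ∃ s ∈ Set.Ioc (0 : ℝ≥0) (1 / ((m : ℝ≥0) + 1)),
      0 < jump (X · ω) s := by
    intro m
    rw [ae_iff]
    set G := {ω | ¬ ∃ s ∈ Set.Ioc (0 : ℝ≥0) (1 / ((m : ℝ≥0) + 1)), 0 < jump (X · ω) s} with hG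
    have hbound : ∀ L : ℝ≥0, P G ≤ ENNReal.ofReal (Real.exp (-L)) := by
      intro L
      -- Only `n + 1` of the `(m + 1) * (n + 1)` blocks of `(0, 1]` lie in the interval of length `1
      -- / (m + 1)`, whence the factor `m + 1`.
      obtain ⟨x, hx, hLx⟩ := htop ((m + 1) * L)
      set δ : ℕ → ℝ≥0 := fun n ↦ 1 / ((m : ℝ≥0) + 1) * (1 / ((n : ℝ≥0) + 1)) with hδdef
      have hδ₀ : ∀ n, 0 < δ n := fun n ↦ by positivity
      have hδ : Tendsto δ atTop (𝓝 0) := by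
        simpa [hδdef] using (tendsto_one_div_add_atTop_nhds_zero_nat (𝕜 := ℝ≥0)).const_mul
          (1 / ((m : ℝ≥0) + 1))
      have hev := hμ.eventually_lt_mul hX hnn hx hδ₀ hδ (N := fun n ↦ (m + 1) * (n + 1))
        (fun n ↦ by simp only [hδdef]; push_cast; field_simp) hLx
      refine measure_le_of_eventually_mem
        (E := fun n ↦ {ω | ∀ j < n + 1, gridIncr (X · ω) (δ n) j ∉ Set.Ici x}) ?_
        (Eventually.frequently ?_)
      · filter_upwards [hX.ae_monotone hnn] with ω hω hωG
        by_contra hcon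
        refine hωG ?_
        obtain ⟨s, hs, hs'⟩ := exists_jump_of_frequently_gridIncr hω
          (fun s ↦ (hX.cadlag ω s).1) isClosed_Ici hx (le_refl (Set.Ici x))
          (c := 1 / ((m : ℝ≥0) + 1)) hδ (N := fun n ↦ n + 1)
          (fun n ↦ le_of_eq (by simp only [hδdef]; push_cast; field_simp))
          ((Filter.not_eventually.1 hcon).mono fun n hn ↦ by
            have hn' : ¬ ∀ j < n + 1, gridIncr (X · ω) (δ n) j ∉ Set.Ici x := hn
            push Not at hn'
            exact hn')
        exact ⟨s, hs, hx.trans_le hs'⟩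
      · filter_upwards [hev] with n hn
        rw [hX.measure_forall_gridIncr_notMem (δ n) (n + 1) measurableSet_Ici]
        refine (one_sub_pow_le_exp prob_le_one _).trans (ENNReal.ofReal_le_ofReal ?_)
        refine Real.exp_le_exp.2 (neg_le_neg ?_)
        have h := (ENNReal.toReal_lt_toReal ENNReal.coe_ne_top
          (ENNReal.mul_ne_top (ENNReal.natCast_ne_top _) (measure_ne_top _ _))).2 hn
        rw [ENNReal.toReal_mul] at h
        simp only [ENNReal.coe_toReal, ENNReal.toReal_natCast] at h
        push_cast at h ⊢
        rw [mul_assoc] at h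
        exact (lt_of_mul_lt_mul_left h (by positivity)).le
    refine le_antisymm ?_ zero_le
    have hlim : Tendsto (fun n : ℕ ↦ ENNReal.ofReal (Real.exp (-((n : ℝ≥0) : ℝ)))) atTop (𝓝 0) := by
      have h1 : Tendsto (fun n : ℕ ↦ Real.exp (-((n : ℝ≥0) : ℝ))) atTop (𝓝 0) := by
        simp only [NNReal.coe_natCast]
        exact Real.tendsto_exp_neg_atTop_nhds_zero.comp tendsto_natCast_atTop_atTop
      simpa using ENNReal.tendsto_ofReal h1
    exact ge_of_tendsto' hlim fun n ↦ hbound n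
  filter_upwards [ae_all_iff.2 key] with ω hω ε hε
  obtain ⟨n, hn⟩ := exists_nat_one_div_lt hε
  obtain ⟨s, hs, hs'⟩ := hω n
  exact ⟨s, ⟨hs.1, hs.2.trans_lt hn⟩, hs'⟩

/-- The expected number of grid increments in `[a, b)` is at most of the order of the Lévy measure
of `[a, b]`. -/
lemma IsLevyMeasure.eventually_mul_le [IsProbabilityMeasure P] (hX : IsLevyProcess X P)
    (hnn : ∀ᵐ ω ∂P, ∀ t, 0 ≤ X t ω) (hμ : IsLevyMeasure μ X P) {a b : ℝ} (ha : 0 < a)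
    {δ : ℕ → ℝ≥0} (hδ : Tendsto δ atTop (𝓝 0)) {N : ℕ → ℕ}
    (hN : ∀ n, N n * δ n = 1) {ε : ℝ} (hε : ε ≤ 1 / 2)
    (hμε : μ (Set.Icc a b) < ENNReal.ofReal ε) :
    ∀ᶠ n in atTop, N n * (P {ω | X (δ n) ω ∈ Set.Ico a b}).toReal ≤ 2 * ε := by
  have hε0 : 0 < ε := ENNReal.ofReal_pos.1 (zero_le.trans_lt hμε)
  set H : ℕ → Set Ω := fun n ↦ {ω | ∀ j < N n, gridIncr (X · ω) (δ n) j ∉ Set.Ico a b}ᶜ with hH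
  have hHm' : ∀ n, MeasurableSet {ω | ∀ j < N n, gridIncr (X · ω) (δ n) j ∉ Set.Ico a b} := by
    intro n
    have e : {ω | ∀ j < N n, gridIncr (X · ω) (δ n) j ∉ Set.Ico a b} =
        ⋂ j ∈ Finset.range (N n), {ω | gridIncr (X · ω) (δ n) j ∈ Set.Ico a b}ᶜ := by
      ext ω; simp
    rw [e]
    exact Finset.measurableSet_biInter _ fun j _ ↦
      (hX.measurable_gridIncr (δ n) j measurableSet_Ico).compl
  have hHm : ∀ n, MeasurableSet (H n) := fun n ↦ (hHm' n).compl
  -- If `H n` occurs infinitely often, the path has a jump in `[a, b]`, so the indicator is at most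
  -- the number of such jumps. The bin becomes closed because limits of increments may equal `b`.
  have hlim : P (limsup H atTop) ≤ μ (Set.Icc a b) := by
    rw [hμ _ measurableSet_Icc (by simp [ha]), ← lintegral_indicator_one
      (MeasurableSet.measurableSet_limsup hHm)]
    refine lintegral_mono_ae ?_
    filter_upwards [hX.ae_monotone hnn] with ω hω
    by_cases hmem : ω ∈ limsup H atTop
    · rw [Set.indicator_of_mem hmem]
      rw [mem_limsup_iff_frequently_mem] at hmem
      obtain ⟨s, hs, hs'⟩ := exists_jump_of_frequently_gridIncr hω
          (fun s ↦ (hX.cadlag ω s).1) isClosed_Icc ha Set.Icc_subset_Ici_self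
          (c := 1) hδ (N := N) (fun n ↦ (hN n).le)
          (hmem.mono fun n hn ↦ by
            have hn' : ¬ ∀ j < N n, gridIncr (X · ω) (δ n) j ∉ Set.Ico a b := hn
            push Not at hn'
            obtain ⟨j, hj, hj'⟩ := hn'
            exact ⟨j, hj, Set.Ico_subset_Icc_self hj'⟩)
      have hne : ({s : ℝ≥0 | s ∈ Set.Ioc 0 1 ∧ jump (X · ω) s ∈ Set.Icc a b}).Nonempty :=
        ⟨s, hs, hs'⟩
      have := Set.one_le_encard_iff_nonempty.2 hne
      simpa using ENat.toENNReal_le.2 this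
    · rw [Set.indicator_of_notMem hmem]
      exact zero_le
  filter_upwards [eventually_measure_lt_of_limsup hHm (hlim.trans_lt hμε)] with n hn
  set q := P {ω | X (δ n) ω ∈ Set.Ico a b} with hq
  have h1 : 1 - P (H n) ≤ ENNReal.ofReal (Real.exp (-(N n * q.toReal))) := by
    rw [← prob_compl_eq_one_sub (hHm n), hH, compl_compl,
      hX.measure_forall_gridIncr_notMem (δ n) (N n) measurableSet_Ico]
    exact one_sub_pow_le_exp prob_le_one _
  have h2 : ENNReal.ofReal (1 - ε) ≤ ENNReal.ofReal (Real.exp (-(N n * q.toReal))) := by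
    refine le_trans ?_ h1
    rw [ENNReal.ofReal_sub _ hε0.le, ENNReal.ofReal_one]
    exact tsub_le_tsub_left hn.le 1
  have h3 := (ENNReal.ofReal_le_ofReal_iff (Real.exp_pos _).le).1 h2
  set y := N n * q.toReal with hy
  have hy0 : 0 ≤ y := by positivity
  -- Together with `1 - ε ≤ exp (-y)` this gives `(1 - ε)(1 + y) ≤ 1`, that is `y ≤ ε / (1 - ε)`,
  -- which is at most `2ε` since `ε ≤ 1/2`.
  have h4 : Real.exp (-y) * (1 + y) ≤ 1 := by
    rw [Real.exp_neg, inv_mul_le_iff₀ (Real.exp_pos _), mul_one]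
    linarith [Real.add_one_le_exp y]
  have h5 : (1 - ε) * (1 + y) ≤ 1 := (mul_le_mul_of_nonneg_right h3 (by linarith)).trans h4
  nlinarith

/-- The probability of two jumps of equal size in `[a, b)` is of second order. -/
lemma IsLevyMeasure.measure_ties_le [IsProbabilityMeasure P] (hX : IsLevyProcess X P)
    (hnn : ∀ᵐ ω ∂P, ∀ t, 0 ≤ X t ω) (hμ : IsLevyMeasure μ X P) {a b : ℝ} (ha : 0 < a)
    {ε : ℝ} (hε : ε ≤ 1 / 2) (hμε : μ (Set.Icc a b) < ENNReal.ofReal ε) (m : ℕ) :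
    P {ω | ∃ s ∈ Set.Ioc (0 : ℝ≥0) m, ∃ t ∈ Set.Ioc (0 : ℝ≥0) m, s ≠ t ∧
      jump (X · ω) s ∈ Set.Ico a b ∧ jump (X · ω) t ∈ Set.Ico a b} ≤
      ENNReal.ofReal (m * (2 * ε)) ^ 2 := by
  set δ : ℕ → ℝ≥0 := fun n ↦ 1 / ((n : ℝ≥0) + 1) with hδdef
  have hδ₀ : ∀ n, 0 < δ n := fun n ↦ by positivity
  have hδ : Tendsto δ atTop (𝓝 0) := tendsto_one_div_add_atTop_nhds_zero_nat
  have hε0 : 0 < ε := ENNReal.ofReal_pos.1 (zero_le.trans_lt hμε)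
  refine measure_le_of_eventually_mem (E := fun n ↦ ⋃ i ∈ Finset.range (m * (n + 1)),
    ⋃ j ∈ Finset.range (m * (n + 1)), {ω | i ≠ j ∧ gridIncr (X · ω) (δ n) i ∈ Set.Ico a b ∧
      gridIncr (X · ω) (δ n) j ∈ Set.Ico a b}) ?_ (Eventually.frequently ?_)
  · filter_upwards [hX.ae_monotone hnn] with ω hω
    rintro ⟨s, hs, t, ht, hst, hjs, hjt⟩
    have := eventually_exists_pair_gridIncr hω (fun s ↦ (hX.cadlag ω s).1) hst hs ht hjs hjt
      hδ₀ hδ (N := fun n ↦ m * (n + 1)) (fun n ↦ by simp only [hδdef]; push_cast; field_simp)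
    filter_upwards [this] with n hn
    obtain ⟨i, hi, j, hj, hij⟩ := hn
    simp only [Set.mem_iUnion, Finset.mem_range]
    exact ⟨i, hi, j, hj, hij⟩
  · filter_upwards [hμ.eventually_mul_le hX hnn ha hδ (N := fun n ↦ n + 1)
      (fun n ↦ by simp only [hδdef]; push_cast; field_simp) hε hμε] with n hn
    set q := P {ω | X (δ n) ω ∈ Set.Ico a b} with hq
    have hpair : ∀ i j, P {ω | i ≠ j ∧ gridIncr (X · ω) (δ n) i ∈ Set.Ico a b ∧
        gridIncr (X · ω) (δ n) j ∈ Set.Ico a b} ≤ q ^ 2 := fun i j ↦ by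
      by_cases hij : i = j
      · simp [hij]
      · have h := ((hX.iIndepFun_gridIncr (δ n)).indepFun hij).measure_inter_preimage_eq_mul
          (Set.Ico a b) (Set.Ico a b) measurableSet_Ico measurableSet_Ico
        have e1 := hX.measure_gridIncr_mem (δ n) i (measurableSet_Ico (a := a) (b := b))
        have e2 := hX.measure_gridIncr_mem (δ n) j (measurableSet_Ico (a := a) (b := b))
        refine (measure_mono (t := (fun ω ↦ gridIncr (X · ω) (δ n) i) ⁻¹' Set.Ico a b ∩
          (fun ω ↦ gridIncr (X · ω) (δ n) j) ⁻¹' Set.Ico a b) fun ω hω ↦ hω.2).trans ?_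
        rw [h, sq]
        exact mul_le_mul' e1.le e2.le
    have hq' : q = ENNReal.ofReal q.toReal := (ENNReal.ofReal_toReal (measure_ne_top _ _)).symm
    calc _ ≤ ∑ i ∈ Finset.range (m * (n + 1)), ∑ j ∈ Finset.range (m * (n + 1)), q ^ 2 :=
          (measure_biUnion_finset_le _ _).trans (Finset.sum_le_sum fun i _ ↦
            (measure_biUnion_finset_le _ _).trans (Finset.sum_le_sum fun j _ ↦ hpair i j))
      _ = (((m * (n + 1) : ℕ) : ℝ≥0∞) * q) ^ 2 := by
          simp only [Finset.sum_const, Finset.card_range, nsmul_eq_mul]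
          ring
      _ ≤ _ := by
          gcongr
          rw [hq', ← ENNReal.ofReal_natCast, ← ENNReal.ofReal_mul (by positivity)]
          refine ENNReal.ofReal_le_ofReal ?_
          push_cast at hn ⊢
          rw [mul_assoc]
          exact mul_le_mul_of_nonneg_left hn (by positivity)

end Levy

/-! ### Distinctness of the jump sizes. -/

section Levy

variable {Ω : Type*} [MeasurableSpace Ω] {P : Measure Ω} {X : ℝ≥0 → Ω → ℝ} {μ : Measure ℝ}

/-- The point beyond which the measure with tail `C x^{-κ}` has mass `u`. -/
def tailQuantile (κ C u : ℝ) : ℝ := (C / u) ^ (1 / κ)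

lemma tailQuantile_pos {κ C u : ℝ} (hC : 0 < C) (hu : 0 < u) : 0 < tailQuantile κ C u :=
  Real.rpow_pos_of_pos (div_pos hC hu) _

lemma tailQuantile_rpow {κ C u : ℝ} (hκ : 0 < κ) (hC : 0 < C) (hu : 0 < u) :
    tailQuantile κ C u ^ κ = C / u := by
  rw [tailQuantile, ← Real.rpow_mul (div_pos hC hu).le, one_div_mul_cancel hκ.ne', Real.rpow_one]

lemma tailQuantile_le_iff {κ C u v : ℝ} (hκ : 0 < κ) (hC : 0 < C) (hu : 0 < u) (hv : 0 < v) :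
    tailQuantile κ C u ≤ v ↔ C / v ^ κ ≤ u := by
  rw [← Real.rpow_le_rpow_iff (tailQuantile_pos hC hu).le hv.le hκ, tailQuantile_rpow hκ hC hu]
  exact div_le_comm₀ hu (Real.rpow_pos_of_pos hv _)

/-- Differences of tails only measure half-open intervals. The spare parameter `u < w` moves the
right end strictly outward, so the closed endpoint is included without a separate discussion of
atoms. -/
lemma measure_Icc_tailQuantile_le {κ C : ℝ} (hκ : 0 < κ) (hC : 0 < C)
    (hμ : ∀ x > 0, μ (Set.Ici x) = ENNReal.ofReal (C / x ^ κ)) {u w z : ℝ} (hu : 0 < u)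
    (huw : u < w) (hwz : w ≤ z) :
    μ (Set.Icc (tailQuantile κ C z) (tailQuantile κ C w)) ≤ ENNReal.ofReal (z - u) := by
  have hw := hu.trans huw
  have hz := hw.trans_le hwz
  have hval : ∀ y > 0, μ (Set.Ici (tailQuantile κ C y)) = ENNReal.ofReal y := fun y hy ↦ by
    rw [hμ _ (tailQuantile_pos hC hy), tailQuantile_rpow hκ hC hy, div_div_cancel₀ hC.ne']
  have hlt : tailQuantile κ C w < tailQuantile κ C u := by
    rw [← not_le, tailQuantile_le_iff hκ hC hu (tailQuantile_pos hC hw),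
      tailQuantile_rpow hκ hC hw, div_div_cancel₀ hC.ne', not_le]
    exact huw
  have hle : tailQuantile κ C z ≤ tailQuantile κ C u := by
    rw [tailQuantile_le_iff hκ hC hz (tailQuantile_pos hC hu), tailQuantile_rpow hκ hC hu,
      div_div_cancel₀ hC.ne']
    linarith
  calc _ ≤ μ (Set.Ici (tailQuantile κ C z) \ Set.Ici (tailQuantile κ C u)) :=
        measure_mono fun x hx ↦ ⟨hx.1, fun h ↦ (hlt.trans_le h).not_ge hx.2⟩
    _ = ENNReal.ofReal (z - u) := by
        rw [measure_sdiff (Set.Ici_subset_Ici.2 hle) measurableSet_Ici.nullMeasurableSet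
          (by rw [hval u hu]; exact ENNReal.ofReal_ne_top), hval z hz, hval u hu,
          ENNReal.ofReal_sub _ hu.le]

/-- Almost surely, no two jumps have the same size. -/
lemma IsLevyMeasure.ae_jump_injective [IsProbabilityMeasure P] (hX : IsLevyProcess X P)
    (hnn : ∀ᵐ ω ∂P, ∀ t, 0 ≤ X t ω) (hμ : IsLevyMeasure μ X P) {κ C : ℝ} (hκ : 0 < κ)
    (hC : 0 < C) (htail : ∀ x > 0, μ (Set.Ici x) = ENNReal.ofReal (C / x ^ κ)) :
    ∀ᵐ ω ∂P, ∀ s t, 0 < jump (X · ω) s → jump (X · ω) s = jump (X · ω) t → s = t := by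
  set G : ℕ → Set Ω := fun m ↦ {ω | ∃ s ∈ Set.Ioc (0 : ℝ≥0) m, ∃ t ∈ Set.Ioc (0 : ℝ≥0) m,
    s ≠ t ∧ jump (X · ω) s = jump (X · ω) t ∧
    jump (X · ω) s ∈ Set.Icc (1 / ((m : ℝ) + 1)) ((m : ℝ) + 1)} with hG
  have hnull : ∀ m, P (G m) = 0 := by
    intro m
    set Λ := C / (1 / ((m : ℝ) + 1)) ^ κ with hΛ
    set u₀ := C / ((m : ℝ) + 1) ^ κ with hu₀
    have hΛ0 : 0 < Λ := div_pos hC (Real.rpow_pos_of_pos (by positivity) _)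
    have hu₀0 : 0 < u₀ := div_pos hC (Real.rpow_pos_of_pos (by positivity) _)
    have hbound : ∀ᶠ ε in 𝓝[>] (0 : ℝ),
        P (G m) ≤ ENNReal.ofReal ((Λ + ε) * (36 * m ^ 2) * ε) := by
      -- Jump sizes are cut into bins of `μ`-mass of order `ε`: about `Λ / ε` bins, each with tie
      -- probability at most `(6mε)²`, for a total of order `ε`. The bound `1/6` makes `3ε ≤ 1/2`,
      -- as `measure_ties_le` requires; the bound `u₀/2` forces the bin index to be at least 2.
      filter_upwards [Ioo_mem_nhdsGT (show (0 : ℝ) < min (1 / 6) (u₀ / 2) by positivity)] with ε hε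
      obtain ⟨hε0, hε1⟩ := hε
      have hε6 : ε < 1 / 6 := hε1.trans_le (min_le_left _ _)
      have hεu : 2 * ε < u₀ := by linarith [hε1.trans_le (min_le_right (1 / 6) (u₀ / 2))]
      set B : ℕ → Set ℝ := fun l ↦
        Set.Ico (tailQuantile κ C (ε * (l + 1))) (tailQuantile κ C (ε * l)) with hB
      have hcover : G m ⊆ ⋃ l ∈ (Finset.range ⌈Λ / ε⌉₊).filter (2 ≤ ·),
          {ω | ∃ s ∈ Set.Ioc (0 : ℝ≥0) m, ∃ t ∈ Set.Ioc (0 : ℝ≥0) m, s ≠ t ∧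
            jump (X · ω) s ∈ B l ∧ jump (X · ω) t ∈ B l} := by
        rintro ω ⟨s, hs, t, ht, hst, hjump, hmem⟩
        set v := jump (X · ω) s with hv
        have hv0 : 0 < v := lt_of_lt_of_le (by positivity) hmem.1
        set u := C / v ^ κ with hu
        have huΛ : u ≤ Λ := div_le_div_of_nonneg_left hC.le (Real.rpow_pos_of_pos (by positivity) _)
          (Real.rpow_le_rpow (by positivity) hmem.1 hκ.le)
        have huu : u₀ ≤ u := div_le_div_of_nonneg_left hC.le (Real.rpow_pos_of_pos hv0 _)
          (Real.rpow_le_rpow hv0.le hmem.2 hκ.le)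
        have hu0 : 0 < u := hu₀0.trans_le huu
        obtain ⟨l, hl⟩ : ∃ l, ⌈u / ε⌉₊ = l + 1 :=
          Nat.exists_eq_succ_of_ne_zero (Nat.ceil_pos.2 (div_pos hu0 hε0)).ne'
        have hl1 : ε * l < u := by
          have := (lt_div_iff₀ hε0).1 (Nat.lt_ceil.1 (show l < ⌈u / ε⌉₊ by omega))
          linarith
        have hl2 : u ≤ ε * (l + 1) := by
          have := Nat.le_ceil (u / ε)
          rw [hl, div_le_iff₀ hε0] at this
          push_cast at this
          linarith
        have hl3 : 2 ≤ l := by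
          have : (1 : ℝ) < l := by nlinarith
          exact_mod_cast this
        have hl0 : (0 : ℝ) < l := by positivity
        have hvB : v ∈ B l :=
          ⟨(tailQuantile_le_iff hκ hC (by positivity) hv0).2 hl2, by
            rw [← not_le, tailQuantile_le_iff hκ hC (by positivity) hv0, not_le]
            exact hl1⟩
        refine Set.mem_iUnion₂.2 ⟨l, Finset.mem_filter.2 ⟨Finset.mem_range.2 ?_, hl3⟩,
          s, hs, t, ht, hst, hvB, hjump ▸ hvB⟩
        have : ⌈u / ε⌉₊ ≤ ⌈Λ / ε⌉₊ := Nat.ceil_mono (by gcongr)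
        omega
      have hbin : ∀ l ∈ (Finset.range ⌈Λ / ε⌉₊).filter (2 ≤ ·),
          P {ω | ∃ s ∈ Set.Ioc (0 : ℝ≥0) m, ∃ t ∈ Set.Ioc (0 : ℝ≥0) m, s ≠ t ∧
            jump (X · ω) s ∈ B l ∧ jump (X · ω) t ∈ B l} ≤
            ENNReal.ofReal (m * (2 * (3 * ε))) ^ 2 := by
        intro l hl
        have hl2 : (2 : ℝ) ≤ l := by exact_mod_cast (Finset.mem_filter.1 hl).2
        refine hμ.measure_ties_le hX hnn (tailQuantile_pos hC (by positivity)) (by linarith) ?_ m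
        -- The quantile parameters are `ε(l - 1) < εl ≤ ε(l + 1)`, so the closed bin has mass at
        -- most `2ε < 3ε`; `l ≥ 2` keeps the first one positive.
        refine lt_of_le_of_lt (measure_Icc_tailQuantile_le hκ hC htail (u := ε * (l - 1))
          (mul_pos hε0 (by linarith)) (by nlinarith) (by nlinarith)) ?_
        refine (ENNReal.ofReal_lt_ofReal_iff (by linarith)).2 ?_
        ring_nf
        linarith
      calc P (G m) ≤ ∑ l ∈ (Finset.range ⌈Λ / ε⌉₊).filter (2 ≤ ·),
            ENNReal.ofReal (m * (2 * (3 * ε))) ^ 2 :=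
            (measure_mono hcover).trans ((measure_biUnion_finset_le _ _).trans
              (Finset.sum_le_sum hbin))
        _ ≤ ∑ l ∈ Finset.range ⌈Λ / ε⌉₊, ENNReal.ofReal (m * (2 * (3 * ε))) ^ 2 :=
            Finset.sum_le_sum_of_subset (Finset.filter_subset _ _)
        _ = ENNReal.ofReal (⌈Λ / ε⌉₊ * (m * (2 * (3 * ε))) ^ 2) := by
            rw [Finset.sum_const, Finset.card_range, nsmul_eq_mul,
              ← ENNReal.ofReal_natCast, ← ENNReal.ofReal_pow (by positivity),
              ← ENNReal.ofReal_mul (by positivity)]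
        _ ≤ _ := by
            refine ENNReal.ofReal_le_ofReal ?_
            have h1 : (⌈Λ / ε⌉₊ : ℝ) ≤ Λ / ε + 1 := (Nat.ceil_lt_add_one (by positivity)).le
            calc (⌈Λ / ε⌉₊ : ℝ) * (m * (2 * (3 * ε))) ^ 2
                ≤ (Λ / ε + 1) * (m * (2 * (3 * ε))) ^ 2 := by gcongr
              _ = (Λ + ε) * (36 * m ^ 2) * ε := by field_simp; ring
    refine le_antisymm ?_ zero_le
    have hlim : Tendsto (fun ε : ℝ ↦ ENNReal.ofReal ((Λ + ε) * (36 * m ^ 2) * ε)) (𝓝[>] 0)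
        (𝓝 0) := by
      have : Continuous fun ε : ℝ ↦ ENNReal.ofReal ((Λ + ε) * (36 * m ^ 2) * ε) :=
        ENNReal.continuous_ofReal.comp (by fun_prop)
      simpa using (this.tendsto 0).mono_left nhdsWithin_le_nhds
    exact ge_of_tendsto hlim hbound
  have hae : ∀ᵐ ω ∂P, ∀ m, ω ∉ G m := ae_all_iff.2 fun m ↦ measure_eq_zero_iff_ae_notMem.1 (hnull m)
  filter_upwards [hae] with ω hω s t hpos hst
  by_contra hne
  have hs0 : 0 < s := by
    refine pos_of_ne_zero fun h ↦ ?_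
    rw [h, jump_zero] at hpos
    exact lt_irrefl _ hpos
  have ht0 : 0 < t := by
    refine pos_of_ne_zero fun h ↦ ?_
    rw [hst, h, jump_zero] at hpos
    exact lt_irrefl _ hpos
  obtain ⟨m₁, hm₁⟩ := exists_nat_ge (max s t)
  obtain ⟨m₂, hm₂⟩ := exists_nat_ge (jump (X · ω) s)
  obtain ⟨m₃, hm₃⟩ := exists_nat_one_div_lt hpos
  set m := max m₁ (max m₂ m₃) with hm
  have h1 : (m₁ : ℝ≥0) ≤ m := by exact_mod_cast le_max_left _ _
  have h2 : (m₂ : ℝ) ≤ m := by exact_mod_cast (le_max_left m₂ m₃).trans (le_max_right m₁ _)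
  have h3 : (m₃ : ℝ) ≤ m := by exact_mod_cast (le_max_right m₂ m₃).trans (le_max_right m₁ _)
  refine hω m ⟨s, ⟨hs0, ((le_max_left s t).trans hm₁).trans h1⟩, t,
    ⟨ht0, ((le_max_right s t).trans hm₁).trans h1⟩, hne, hst, ?_, by linarith⟩
  exact (one_div_le_one_div_of_le (by positivity) (by linarith)).trans hm₃.le

end Levy

/-! ### The largest of exchangeable increments before a crossing -/

section Exchangeable

/-- The second coordinates of `d` have partial sums crossing level `1` at step `k`, and the `j`-th
of the preceding first coordinates is the strict maximum of these. -/
def crossingMax (k j : ℕ) : Set (ℕ → ℝ × ℝ) :=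
  {d | (∑ i ∈ Finset.range k, (d i).2 ≤ 1 ∧ 1 < ∑ i ∈ Finset.range (k + 1), (d i).2) ∧
    IsStrictMax (fun i ↦ (d i).1) k j}

/-- The value of `u k j d` for the pair `(k, j)` with `d ∈ crossingMax k j`, and `0` if there is no
such pair. -/
def atCrossingMax (u : ℕ → ℕ → (ℕ → ℝ × ℝ) → ℝ≥0∞) (d : ℕ → ℝ × ℝ) : ℝ≥0∞ :=
  ∑' k, ∑ j ∈ Finset.range k, (crossingMax k j).indicator (u k j) d

/-- The largest increment before the crossing, the sum before it, and the increment over it. -/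
def crossingData (k j : ℕ) (d : ℕ → ℝ × ℝ) : ℝ × ℝ × ℝ × ℝ :=
  ((d j).1, ∑ i ∈ Finset.range k, (d i).2, d k)

lemma measurable_crossingData (k j : ℕ) : Measurable (crossingData k j) := by
  unfold crossingData
  fun_prop

lemma measurableSet_crossingMax (k j : ℕ) : MeasurableSet (crossingMax k j) := by
  have h1 : ∀ n, Measurable fun d : ℕ → ℝ × ℝ ↦ ∑ i ∈ Finset.range n, (d i).2 := fun n ↦ by fun_prop
  have h2 : ∀ n, Measurable fun d : ℕ → ℝ × ℝ ↦ (d n).1 := fun n ↦ by fun_prop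
  refine ((measurableSet_le (h1 k) measurable_const).inter
    (measurableSet_lt measurable_const (h1 (k + 1)))).inter ?_
  have e : {d : ℕ → ℝ × ℝ | IsStrictMax (fun i ↦ (d i).1) k j} =
      {_d | j < k} ∩ ⋂ i, ⋂ (_ : i < k), ⋂ (_ : i ≠ j), {d | (d i).1 < (d j).1} := by
    ext d; simp [IsStrictMax]
  have := (MeasurableSet.const (α := ℕ → ℝ × ℝ) (j < k)).inter (MeasurableSet.iInter fun i ↦
    MeasurableSet.iInter fun (_ : i < k) ↦ MeasurableSet.iInter fun (_ : i ≠ j) ↦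
      measurableSet_lt (h2 i) (h2 j))
  rw [← e] at this
  exact this

lemma measurable_atCrossingMax {u : ℕ → ℕ → (ℕ → ℝ × ℝ) → ℝ≥0∞}
    (hu : ∀ k j, Measurable (u k j)) : Measurable (atCrossingMax u) :=
  Measurable.tsum fun k ↦ Finset.measurable_fun_sum _ fun j _ ↦
    (hu k j).indicator (measurableSet_crossingMax k j)

lemma IsStrictMax.unique {d : ℕ → ℝ} {k i j : ℕ} (hi : IsStrictMax d k i)
    (hj : IsStrictMax d k j) : i = j := by
  by_contra h
  exact lt_asymm (hi.2 j hj.1 (Ne.symm h)) (hj.2 i hi.1 h)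

/-- Nonnegative second coordinates have monotone partial sums, which cross the level once. Hence at
most one term of `atCrossingMax` is nonzero. -/
lemma crossing_unique {d : ℕ → ℝ × ℝ} (hd : ∀ i, 0 ≤ (d i).2) {k l i j : ℕ}
    (hk : d ∈ crossingMax k i) (hl : d ∈ crossingMax l j) : k = l := by
  have hmono : Monotone fun n ↦ ∑ i ∈ Finset.range n, (d i).2 := fun m n hmn ↦
    Finset.sum_le_sum_of_subset_of_nonneg (Finset.range_mono hmn) fun i _ _ ↦ hd i
  by_contra h
  rcases lt_or_gt_of_ne h with h | h
  · exact (hk.1.2.trans_le (hmono (show k + 1 ≤ l from h))).not_ge hl.1.1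
  · exact (hl.1.2.trans_le (hmono (show l + 1 ≤ k from h))).not_ge hk.1.1

lemma atCrossingMax_eq {u : ℕ → ℕ → (ℕ → ℝ × ℝ) → ℝ≥0∞} {d : ℕ → ℝ × ℝ}
    (hd : ∀ i, 0 ≤ (d i).2) {k j : ℕ} (h : d ∈ crossingMax k j) :
    atCrossingMax u d = u k j d := by
  rw [atCrossingMax, tsum_eq_single k fun l hl ↦ Finset.sum_eq_zero fun i _ ↦
    Set.indicator_of_notMem (fun h' ↦ hl (crossing_unique hd h' h)) _,
    Finset.sum_eq_single j (fun i _ hi ↦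
      Set.indicator_of_notMem (fun h' ↦ hi (h'.2.unique h.2)) _)
      (fun hj ↦ absurd (Finset.mem_range.2 h.2.1) hj), Set.indicator_of_mem h]

lemma atCrossingMax_le {u : ℕ → ℕ → (ℕ → ℝ × ℝ) → ℝ≥0∞} {d : ℕ → ℝ × ℝ} {c : ℝ≥0∞}
    (hd : ∀ i, 0 ≤ (d i).2) (hu : ∀ k j, j < k → u k j d ≤ c) : atCrossingMax u d ≤ c := by
  by_cases h : ∃ k j, d ∈ crossingMax k j
  · obtain ⟨k, j, h⟩ := h
    rw [atCrossingMax_eq hd h]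
    exact hu k j h.2.1
  · push Not at h
    simp [atCrossingMax, Set.indicator_of_notMem (h _ _)]

lemma sum_range_swap (d : ℕ → ℝ × ℝ) {k i j n : ℕ} (hi : i < k) (hj : j < k) (hn : k ≤ n) :
    ∑ l ∈ Finset.range n, (d (Equiv.swap i j l)).2 = ∑ l ∈ Finset.range n, (d l).2 := by
  refine Equiv.Perm.sum_comp (Equiv.swap i j) (Finset.range n) (fun l ↦ (d l).2) fun l hl ↦ ?_
  by_contra h
  have hl' : n ≤ l := by simpa using h
  exact hl (Equiv.swap_apply_of_ne_of_ne (by omega) (by omega))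

lemma IsStrictMax.swap {d : ℕ → ℝ} {k i j : ℕ} (hj : j < k)
    (h : IsStrictMax d k i) : IsStrictMax (fun l ↦ d (Equiv.swap i j l)) k j := by
  refine ⟨hj, fun l hl hlj ↦ ?_⟩
  simp only [Equiv.swap_apply_right]
  refine h.2 _ ?_ fun h' ↦ hlj ?_
  · rw [Equiv.swap_apply_def]
    split_ifs
    exacts [hj, hl]
  · exact (Equiv.swap i j).injective (h'.trans (Equiv.swap_apply_right i j).symm)

/-- Both indices are below `k`, so the sums of lengths `k` and `k + 1` are unchanged while the
maximum moves from `i` to `j`. -/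
lemma swap_mem_crossingMax {d : ℕ → ℝ × ℝ} {k i j : ℕ} (hi : i < k) (hj : j < k)
    (h : d ∈ crossingMax k i) : (fun l ↦ d (Equiv.swap i j l)) ∈ crossingMax k j := by
  refine ⟨?_, h.2.swap hj⟩
  rw [sum_range_swap d hi hj le_rfl, sum_range_swap d hi hj k.le_succ]
  exact h.1

lemma swap_mem_crossingMax_iff {d : ℕ → ℝ × ℝ} {k i j : ℕ} (hi : i < k) (hj : j < k) :
    (fun l ↦ d (Equiv.swap i j l)) ∈ crossingMax k j ↔ d ∈ crossingMax k i := by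
  refine ⟨fun h ↦ ?_, swap_mem_crossingMax hi hj⟩
  have := swap_mem_crossingMax hj hi h
  simpa [Equiv.swap_comm j i] using this

lemma crossingData_swap (d : ℕ → ℝ × ℝ) {k i j : ℕ} (hi : i < k) (hj : j < k) :
    crossingData k j (fun l ↦ d (Equiv.swap i j l)) = crossingData k i d := by
  simp only [crossingData, Equiv.swap_apply_right, sum_range_swap d hi hj le_rfl,
    Equiv.swap_apply_of_ne_of_ne hi.ne' hj.ne']

/-- For exchangeable increments, the position of the largest increment before the crossing is
uniform given the crossing data. -/
theorem lintegral_atCrossingMax_eq_average {Q : Measure (ℕ → ℝ × ℝ)}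
    (hQ : ∀ i j : ℕ, MeasurePreserving (fun d l ↦ d (Equiv.swap i j l)) Q Q)
    (w : ℕ → ℕ → ℝ≥0∞) {g : ℝ × ℝ × ℝ × ℝ → ℝ≥0∞} (hg : Measurable g) :
    ∫⁻ d, atCrossingMax (fun k j d ↦ w k j * g (crossingData k j d)) d ∂Q =
      ∫⁻ d, atCrossingMax (fun k j d ↦ (∑ i ∈ Finset.range k, w k i) / k *
        g (crossingData k j d)) d ∂Q := by
  have hgm : ∀ k j, Measurable fun d ↦ g (crossingData k j d) := fun k j ↦
    hg.comp (measurable_crossingData k j)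
  -- By exchangeability `e k j` does not depend on `j < k`, so for each `k` the weights matter only
  -- through their sum.
  set e : ℕ → ℕ → ℝ≥0∞ := fun k j ↦ ∫⁻ d in crossingMax k j, g (crossingData k j d) ∂Q with he
  have hexp : ∀ v : ℕ → ℕ → ℝ≥0∞,
      ∫⁻ d, atCrossingMax (fun k j d ↦ v k j * g (crossingData k j d)) d ∂Q =
      ∑' k, ∑ j ∈ Finset.range k, v k j * e k j := fun v ↦ by
    have hm : ∀ k j, Measurable ((crossingMax k j).indicator
        fun d ↦ v k j * g (crossingData k j d)) := fun k j ↦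
      ((hgm k j).const_mul _).indicator (measurableSet_crossingMax k j)
    simp only [atCrossingMax]
    rw [lintegral_tsum fun k ↦ (Finset.measurable_fun_sum _ fun j _ ↦ hm k j).aemeasurable]
    refine tsum_congr fun k ↦ ?_
    rw [lintegral_finsetSum _ fun j _ ↦ hm k j]
    refine Finset.sum_congr rfl fun j _ ↦ ?_
    rw [lintegral_indicator (measurableSet_crossingMax k j), lintegral_const_mul _ (hgm k j)]
  have heq : ∀ k i j, i < k → j < k → e k i = e k j := fun k i j hi hj ↦ by
    simp only [he]
    rw [← lintegral_indicator (measurableSet_crossingMax k i),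
      ← lintegral_indicator (measurableSet_crossingMax k j),
      ← (hQ i j).lintegral_comp ((hgm k j).indicator (measurableSet_crossingMax k j))]
    refine lintegral_congr fun d ↦ ?_
    by_cases h : d ∈ crossingMax k i
    · rw [Set.indicator_of_mem h, Set.indicator_of_mem (swap_mem_crossingMax hi hj h),
        crossingData_swap d hi hj]
    · rw [Set.indicator_of_notMem h, Set.indicator_of_notMem fun h' ↦
        h ((swap_mem_crossingMax_iff hi hj).1 h')]
  rw [hexp, hexp fun k _ ↦ (∑ i ∈ Finset.range k, w k i) / k]
  refine tsum_congr fun k ↦ ?_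
  rcases Nat.eq_zero_or_pos k with rfl | hk
  · simp
  · have h1 : ∀ v : ℕ → ℝ≥0∞, ∑ j ∈ Finset.range k, v j * e k j =
        (∑ j ∈ Finset.range k, v j) * e k 0 := fun v ↦ by
      rw [Finset.sum_mul]
      exact Finset.sum_congr rfl fun j hj ↦ by rw [heq k j 0 (Finset.mem_range.1 hj) hk]
    rw [h1, h1 fun _ ↦ (∑ i ∈ Finset.range k, w k i) / k, Finset.sum_const, Finset.card_range,
      nsmul_eq_mul, ENNReal.mul_div_cancel (by exact_mod_cast hk.ne') (ENNReal.natCast_ne_top k)]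

/-- The law of a sequence of independent identically distributed variables is exchangeable. -/
lemma measurePreserving_swap_of_iid {Ω : Type*} [MeasurableSpace Ω] {P : Measure Ω}
    {D : ℕ → Ω → ℝ × ℝ} (hm : ∀ i, Measurable (D i)) (hind : iIndepFun D P)
    (hid : ∀ i, P.map (D i) = P.map (D 0)) (i j : ℕ) :
    MeasurePreserving (fun d l ↦ d (Equiv.swap i j l)) (P.map fun ω l ↦ D l ω)
      (P.map fun ω l ↦ D l ω) := by
  have hs : Measurable fun (d : ℕ → ℝ × ℝ) l ↦ d (Equiv.swap i j l) := by fun_prop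
  refine ⟨hs, ?_⟩
  rw [Measure.map_map hs (measurable_pi_lambda _ hm)]
  have h1 := hind.map_fun_eq_infinitePi_map hm
  have h2 := (hind.precomp (Equiv.swap i j).injective).map_fun_eq_infinitePi_map
    fun l ↦ hm (Equiv.swap i j l)
  have e : (fun l ↦ P.map (D (Equiv.swap i j l))) = fun l ↦ P.map (D l) := by
    ext1 l
    rw [hid, hid l]
  simp only [Function.comp_def] at h2 ⊢
  rw [h1, h2]
  congr 1

end Exchangeable

/-! ### Convergence of averages to the uniform law -/

section Uniform

open scoped BoundedContinuousFunction

/-- The statement for products over finite families, specialised to one-point index types. -/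
lemma ext_of_lintegral_mul_boundedContinuousFunction {Z T : Type*}
    [MeasurableSpace Z] [TopologicalSpace Z] [BorelSpace Z] [HasOuterApproxClosed Z]
    [MeasurableSpace T] [TopologicalSpace T] [BorelSpace T] [HasOuterApproxClosed T]
    {μ ν : Measure (Z × T)} [IsFiniteMeasure μ]
    (h : ∀ (f : Z →ᵇ ℝ≥0) (g : T →ᵇ ℝ≥0),
      ∫⁻ p, (f p.1 : ℝ≥0∞) * g p.2 ∂μ = ∫⁻ p, (f p.1 : ℝ≥0∞) * g p.2 ∂ν) :
    μ = ν := by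
  let e : (Z × T) ≃ᵐ ((Unit → Z) × (Unit → T)) :=
    .symm <| .prodCongr (.funUnique ..) (.funUnique ..)
  rw [← e.map_measurableEquiv_injective.eq_iff]
  have : IsFiniteMeasure (μ.map e) := Measure.isFiniteMeasure_map _ _
  refine Measure.ext_of_lintegral_prod_mul_prod_boundedContinuousFunction fun f g ↦ ?_
  rw [lintegral_map_equiv, lintegral_map_equiv]
  simp only [Finset.univ_unique, Finset.prod_singleton]
  exact h (f ()) (g ())

/-- Riemann sums over `[0, 1]` with right end points. -/
lemma lintegral_ceil_eq_average (f : ℝ → ℝ≥0) {k : ℕ} (hk : 0 < k) :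
    ∫⁻ x in Set.Ioc (0 : ℝ) 1, (f ((⌈(x * k : ℝ)⌉₊ : ℝ) / k) : ℝ≥0∞) =
      (∑ j ∈ Finset.range k, (f (((j + 1 : ℕ) : ℝ) / k) : ℝ≥0∞)) / k := by
  have hk' : (0 : ℝ) < k := by exact_mod_cast hk
  have hU : Set.Ioc (0 : ℝ) 1 =
      ⋃ j ∈ Finset.range k, Set.Ioc ((j : ℝ) / k) (((j + 1 : ℕ) : ℝ) / k) := by
    ext x
    simp only [Set.mem_iUnion, Finset.mem_range, exists_prop]
    constructor
    · intro hx
      obtain ⟨j, hj⟩ : ∃ j, ⌈x * k⌉₊ = j + 1 :=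
        Nat.exists_eq_succ_of_ne_zero (Nat.ceil_pos.2 (mul_pos hx.1 hk')).ne'
      have h1 : ⌈x * k⌉₊ ≤ k := Nat.ceil_le.2 (by nlinarith [hx.2])
      refine ⟨j, by omega, (div_lt_iff₀ hk').2 (Nat.lt_ceil.1 (by omega)), ?_⟩
      rw [← hj]
      exact (le_div_iff₀ hk').2 (Nat.le_ceil _)
    · rintro ⟨j, hj, hx⟩
      refine ⟨lt_of_le_of_lt (by positivity) hx.1, hx.2.trans ((div_le_one hk').2 ?_)⟩
      exact_mod_cast hj
  have hceil : ∀ j : ℕ, ∀ x ∈ Set.Ioc ((j : ℝ) / k) (((j + 1 : ℕ) : ℝ) / k),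
      ⌈x * k⌉₊ = j + 1 := fun j x hx ↦ by
    refine le_antisymm (Nat.ceil_le.2 ((le_div_iff₀ hk').1 hx.2)) ?_
    exact Nat.lt_ceil.2 ((div_lt_iff₀ hk').1 hx.1)
  rw [hU, lintegral_biUnion_finset (fun i _ j _ hij ↦ ?_) (fun j _ ↦ measurableSet_Ioc)]
  · rw [ENNReal.div_eq_inv_mul, Finset.mul_sum]
    refine Finset.sum_congr rfl fun j _ ↦ ?_
    rw [setLIntegral_congr_fun (g := fun _ ↦ (f (((j + 1 : ℕ) : ℝ) / k) : ℝ≥0∞)) measurableSet_Ioc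
      fun x hx ↦ by simp only [hceil j x hx], setLIntegral_const, Real.volume_Ioc, mul_comm]
    congr 1
    rw [← sub_div]
    push_cast
    rw [add_sub_cancel_left, ENNReal.ofReal_div_of_pos hk', ENNReal.ofReal_one,
      ENNReal.ofReal_natCast, one_div]
  · refine Set.disjoint_left.2 fun x hx hx' ↦ hij ?_
    have := (hceil i x hx).symm.trans (hceil j x hx')
    omega

/-- The average is the integral of `f (⌈xk⌉ / k)` over `(0, 1]`, and `⌈xk⌉ / k → x`. -/
lemma tendsto_average_lintegral (f : ℝ →ᵇ ℝ≥0) :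
    Tendsto (fun k : ℕ ↦ (∑ j ∈ Finset.range k, (f (((j + 1 : ℕ) : ℝ) / k) : ℝ≥0∞)) / k) atTop
      (𝓝 (∫⁻ x in Set.Icc (0 : ℝ) 1, f x)) := by
  rw [setLIntegral_congr Ioc_ae_eq_Icc.symm]
  have h : Tendsto (fun k : ℕ ↦ ∫⁻ x in Set.Ioc (0 : ℝ) 1, (f ((⌈(x * k : ℝ)⌉₊ : ℝ) / k) : ℝ≥0∞))
      atTop (𝓝 (∫⁻ x in Set.Ioc (0 : ℝ) 1, f x)) := by
    refine tendsto_lintegral_of_dominated_convergence (fun _ ↦ (nndist 0 f : ℝ≥0∞)) (fun k ↦ ?_)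
      (fun k ↦ Eventually.of_forall fun x ↦ ?_) ?_ ?_
    · have hc : Measurable fun x : ℝ ↦ ((⌈(x * k : ℝ)⌉₊ : ℝ) / k) := by fun_prop
      exact (f.continuous.measurable.comp hc).coe_nnreal_ennreal
    · exact ENNReal.coe_le_coe.2 (f.apply_le_nndist_zero _)
    · simp
    · filter_upwards [ae_restrict_mem measurableSet_Ioc] with x hx
      refine ENNReal.tendsto_coe.2 ((f.continuous.tendsto x).comp ?_)
      exact (tendsto_nat_ceil_mul_div_atTop (R := ℝ) hx.1.le).comp tendsto_natCast_atTop_atTop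
  refine h.congr' ?_
  filter_upwards [eventually_gt_atTop 0] with k hk
  exact lintegral_ceil_eq_average f hk

end Uniform

/-! ### The relative position of the largest jump -/

section Position

open scoped BoundedContinuousFunction

/-- The almost sure properties of the paths that determine the limit of the discretised
functionals. -/
structure IsRegularPath (f₁ f₂ : ℝ≥0 → ℝ) : Prop where
  mono₁ : Monotone f₁
  mono₂ : Monotone f₂
  right₁ : ∀ s, ContinuousWithinAt f₁ (Set.Ici s) s
  right₂ : ∀ s, ContinuousWithinAt f₂ (Set.Ici s) s
  zero₂ : f₂ 0 = 0
  unbounded : ∃ x, 1 < f₂ x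
  jumps : ∀ ε > 0, ∃ s ∈ Set.Ioo 0 ε, 0 < jump f₁ s
  distinct : ∀ s t, 0 < jump f₁ s → jump f₁ s = jump f₁ t → s = t

/-- The position of the largest jump before the first passage, relative to the passage time. -/
def relPosition (f₁ f₂ : ℝ≥0 → ℝ) : ℝ := (Fstar f₁ f₂ : ℝ) / firstAbove f₂ 1

/-- The largest jump before the first passage, the level before it and the jump over it. -/
def passageData (f₁ f₂ : ℝ≥0 → ℝ) : ℝ × ℝ × ℝ × ℝ :=
  (I₁ f₁ f₂, Function.leftLim f₂ (firstAbove f₂ 1), jump f₁ (firstAbove f₂ 1),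
    jump f₂ (firstAbove f₂ 1))

variable {f₁ f₂ : ℝ≥0 → ℝ}

lemma IsRegularPath.firstAbove_pos (h : IsRegularPath f₁ f₂) : 0 < firstAbove f₂ 1 :=
  StableJump.firstAbove_pos h.mono₂ (h.right₂ 0) h.zero₂ h.unbounded

lemma IsRegularPath.gridIncr_snd_nonneg (h : IsRegularPath f₁ f₂) (δ : ℝ≥0) (j : ℕ) :
    0 ≤ (gridIncr (fun t ↦ (f₁ t, f₂ t)) δ j).2 :=
  sub_nonneg.2 (h.mono₂ (by gcongr; omega))

lemma IsRegularPath.sum_gridIncr (h : IsRegularPath f₁ f₂) (δ : ℝ≥0) (k : ℕ) :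
    ∑ i ∈ Finset.range k, (gridIncr (fun t ↦ (f₁ t, f₂ t)) δ i).2 = f₂ (k * δ) := by
  have := Finset.sum_range_sub (fun j : ℕ ↦ f₂ (j * δ)) k
  simpa [gridIncr, h.zero₂] using this

lemma IsRegularPath.exists_approx (h : IsRegularPath f₁ f₂) {δ : ℕ → ℝ≥0} (hδ₀ : ∀ n, 0 < δ n)
    (hδ : Tendsto δ atTop (𝓝 0)) (hT : ∀ n (k : ℕ), firstAbove f₂ 1 ≠ k * δ n) :
    ∃ k j : ℕ → ℕ,
      (∀ᶠ n in atTop, gridIncr (fun t ↦ (f₁ t, f₂ t)) (δ n) ∈ crossingMax (k n) (j n)) ∧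
      Tendsto k atTop atTop ∧
      Tendsto (fun n ↦ ((j n + 1 : ℕ) : ℝ) / k n) atTop (𝓝 (relPosition f₁ f₂)) ∧
      Tendsto (fun n ↦ crossingData (k n) (j n) (gridIncr (fun t ↦ (f₁ t, f₂ t)) (δ n))) atTop
        (𝓝 (passageData f₁ f₂)) := by
  obtain ⟨k, j, h1, h2, h3, h4, h5, h6, h7, h8⟩ := exists_grid_approx h.mono₁ h.mono₂ h.right₁
    h.right₂ h.zero₂ h.unbounded (h.jumps _ h.firstAbove_pos) h.distinct hδ₀ hδ hT
  refine ⟨k, j, ?_, h3, h4, ?_⟩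
  · filter_upwards [h2] with n hn
    refine ⟨?_, hn⟩
    rw [h.sum_gridIncr, h.sum_gridIncr]
    exact h1 n
  · simp only [crossingData, h.sum_gridIncr]
    exact h5.prodMk_nhds (h6.prodMk_nhds (h7.prodMk_nhds h8))

variable {Ω : Type*} [MeasurableSpace Ω] {P : Measure Ω} {Y₁ Y₂ : ℝ≥0 → Ω → ℝ}

/-- A monotone path exceeds 1 at every time after the passage, so the infimum may be taken over a
countable dense set of times. -/
lemma aemeasurable_firstAbove (hm : ∀ t, Measurable (Y₂ t)) (hreg : ∀ᵐ ω ∂P,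
    IsRegularPath (Y₁ · ω) (Y₂ · ω)) : AEMeasurable (fun ω ↦ (firstAbove (Y₂ · ω) 1 : ℝ)) P := by
  obtain ⟨D, hDc, hD⟩ := TopologicalSpace.exists_countable_dense ℝ≥0
  have : Countable D := hDc.to_subtype
  set τ : Ω → ℝ≥0∞ := fun ω ↦ ⨅ q : D, {ω | 1 < Y₂ q ω}.piecewise
    (fun _ ↦ ((q : ℝ≥0) : ℝ≥0∞)) (fun _ ↦ ⊤) ω with hτ
  have hτm : Measurable τ := Measurable.iInf fun q ↦
    Measurable.piecewise (measurableSet_lt measurable_const (hm q)) measurable_const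
      measurable_const
  refine ⟨fun ω ↦ (τ ω).toReal, hτm.ennreal_toReal, ?_⟩
  filter_upwards [hreg] with ω hω
  suffices τ ω = firstAbove (Y₂ · ω) 1 by rw [this, ENNReal.coe_toReal]
  refine le_antisymm (le_of_forall_gt fun c hc ↦ ?_) (le_iInf fun q ↦ ?_)
  · obtain ⟨c', hc', hc''⟩ := ENNReal.lt_iff_exists_nnreal_btwn.1 hc
    obtain ⟨q, hqD, hq⟩ := hD.exists_mem_open isOpen_Ioo
      (Set.nonempty_Ioo.2 (ENNReal.coe_lt_coe.1 hc'))
    refine lt_of_le_of_lt (iInf_le _ ⟨q, hqD⟩) ?_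
    rw [Set.piecewise_eq_of_mem _ _ _
      (show ω ∈ {ω | 1 < Y₂ q ω} from one_lt_of_firstAbove_lt hω.mono₂ hω.unbounded hq.1)]
    exact (ENNReal.coe_lt_coe.2 hq.2).trans hc''
  · by_cases hq : 1 < Y₂ q ω
    · rw [Set.piecewise_eq_of_mem _ _ _ (show ω ∈ {ω | 1 < Y₂ q ω} from hq)]
      exact ENNReal.coe_le_coe.2 (csInf_le (s := {x | 1 < Y₂ x ω}) (OrderBot.bddBelow _) hq)
    · rw [Set.piecewise_eq_of_notMem _ _ _ (show ω ∉ {ω | 1 < Y₂ q ω} from hq)]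
      exact le_top

/-- Some grid, together with all its refinements, almost surely avoids a random time. -/
lemma exists_grid_avoiding [IsFiniteMeasure P] {τ : Ω → ℝ≥0}
    (hτ : AEMeasurable (fun ω ↦ (τ ω : ℝ)) P) (hpos : ∀ᵐ ω ∂P, 0 < τ ω) :
    ∃ δ : ℕ → ℝ≥0, (∀ n, 0 < δ n) ∧ Tendsto δ atTop (𝓝 0) ∧
      ∀ᵐ ω ∂P, ∀ n (k : ℕ), τ ω ≠ k * δ n := by
  obtain ⟨τ', hm, he⟩ := hτ
  -- Only countably many values carry positive probability, so all but countably many scales `h`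
  -- give grids of mesh `h / (n + 1)` whose positive points avoid them.
  have hS := Measure.countable_meas_level_set_pos (μ := P) hm
  set S := {t : ℝ | 0 < P {ω | τ' ω = t}} with hSdef
  have hbad : (⋃ p : ℕ × ℕ,
      (fun h : ℝ ↦ ((p.2 : ℝ) + 1) * (h * (1 / ((p.1 : ℝ) + 1)))) ⁻¹' S).Countable := by
    refine Set.countable_iUnion fun p ↦ hS.preimage fun x y hxy ↦ ?_
    have h1 : ((p.2 : ℝ) + 1) ≠ 0 := by positivity
    have h2 : (1 / ((p.1 : ℝ) + 1)) ≠ 0 := by positivity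
    exact mul_right_cancel₀ h2 (mul_left_cancel₀ h1 hxy)
  obtain ⟨h, hhbad, hh⟩ := (hbad.dense_compl ℝ).exists_mem_open isOpen_Ioi ⟨1, zero_lt_one' ℝ⟩
  have hh0 : (0 : ℝ) < h := hh
  lift h to ℝ≥0 using hh0.le
  have hh1 : 0 < h := by exact_mod_cast hh0
  refine ⟨fun n ↦ h * (1 / ((n : ℝ≥0) + 1)), fun n ↦ by positivity, ?_, ?_⟩
  · simpa using (tendsto_one_div_add_atTop_nhds_zero_nat (𝕜 := ℝ≥0)).const_mul h
  · have hnull : ∀ n k : ℕ, ∀ᵐ ω ∂P, τ' ω ≠ ((k : ℝ) + 1) * (h * (1 / ((n : ℝ) + 1))) := by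
      intro n k
      have : ((k : ℝ) + 1) * (h * (1 / ((n : ℝ) + 1))) ∉ S := fun hS' ↦
        hhbad (Set.mem_iUnion.2 ⟨(n, k), hS'⟩)
      have h0 : P {ω | τ' ω = ((k : ℝ) + 1) * (h * (1 / ((n : ℝ) + 1)))} = 0 := by
        simpa [hSdef] using this
      exact measure_eq_zero_iff_ae_notMem.1 h0
    filter_upwards [ae_all_iff.2 fun n ↦ ae_all_iff.2 (hnull n), he, hpos] with ω h1 h2 h3 n k hk
    rcases k with _ | k
    · simp [h3.ne'] at hk
    · refine h1 n k ?_
      rw [← h2, hk]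
      push_cast
      ring

section Limit

variable {δ : ℕ → ℝ≥0}

/-- The path functionals involve uncountably many times; measurability comes from writing them as
almost sure limits of grid functionals. As `atCrossingMax` takes values in `[0, ∞]`, `φ` is split
into positive and negative parts. -/
lemma aemeasurable_of_continuous (hY : IsLevyProcess (fun t ω ↦ (Y₁ t ω, Y₂ t ω)) P)
    (hreg : ∀ᵐ ω ∂P, IsRegularPath (Y₁ · ω) (Y₂ · ω)) (hδ₀ : ∀ n, 0 < δ n)
    (hδ : Tendsto δ atTop (𝓝 0)) (hT : ∀ᵐ ω ∂P, ∀ n (k : ℕ), firstAbove (Y₂ · ω) 1 ≠ k * δ n)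
    {φ : ℝ × ℝ × ℝ × ℝ × ℝ → ℝ} (hφ : Continuous φ) :
    AEMeasurable (fun ω ↦ φ (relPosition (Y₁ · ω) (Y₂ · ω), passageData (Y₁ · ω) (Y₂ · ω))) P := by
  set u : (ℝ × ℝ × ℝ × ℝ × ℝ → ℝ) → ℕ → ℕ → (ℕ → ℝ × ℝ) → ℝ≥0∞ := fun φ k j d ↦
    ENNReal.ofReal (φ (((j + 1 : ℕ) : ℝ) / k, crossingData k j d)) with hu
  have hum : ∀ φ : ℝ × ℝ × ℝ × ℝ × ℝ → ℝ, Continuous φ → ∀ k j, Measurable (u φ k j) :=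
    fun φ hφ k j ↦ ENNReal.measurable_ofReal.comp (hφ.measurable.comp
      (measurable_const.prodMk (measurable_crossingData k j)))
  have hdm : ∀ n, Measurable fun ω ↦ gridIncr (fun t ↦ (Y₁ t ω, Y₂ t ω)) (δ n) := fun n ↦
    measurable_pi_lambda _ fun j ↦ hY.measurable_gridIncr (δ n) j
  refine aemeasurable_of_tendsto_metrizable_ae atTop
    (f := fun n ω ↦ (atCrossingMax (u φ) (gridIncr (fun t ↦ (Y₁ t ω, Y₂ t ω)) (δ n))).toReal -
      (atCrossingMax (u (-φ)) (gridIncr (fun t ↦ (Y₁ t ω, Y₂ t ω)) (δ n))).toReal)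
    (fun n ↦ Measurable.aemeasurable ?_) ?_
  · exact ((measurable_atCrossingMax (hum φ hφ)).comp (hdm n)).ennreal_toReal.sub
      ((measurable_atCrossingMax (hum _ hφ.neg)).comp (hdm n)).ennreal_toReal
  · filter_upwards [hreg, hT] with ω hω hTω
    obtain ⟨k, j, h1, -, h3, h4⟩ := hω.exists_approx hδ₀ hδ hTω
    refine ((hφ.tendsto _).comp (h3.prodMk_nhds h4)).congr' ?_
    filter_upwards [h1] with n hn
    rw [atCrossingMax_eq (hω.gridIncr_snd_nonneg _) hn,
      atCrossingMax_eq (hω.gridIncr_snd_nonneg _) hn]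
    simp only [hu, Function.comp_apply, Pi.neg_apply, ENNReal.toReal_ofReal']
    exact (max_zero_sub_max_neg_zero_eq_self _).symm

lemma aemeasurable_prodMk_passage (hY : IsLevyProcess (fun t ω ↦ (Y₁ t ω, Y₂ t ω)) P)
    (hreg : ∀ᵐ ω ∂P, IsRegularPath (Y₁ · ω) (Y₂ · ω)) (hδ₀ : ∀ n, 0 < δ n)
    (hδ : Tendsto δ atTop (𝓝 0)) (hT : ∀ᵐ ω ∂P, ∀ n (k : ℕ), firstAbove (Y₂ · ω) 1 ≠ k * δ n) :
    AEMeasurable (fun ω ↦ (relPosition (Y₁ · ω) (Y₂ · ω), passageData (Y₁ · ω) (Y₂ · ω))) P := by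
  have h := fun {φ : ℝ × ℝ × ℝ × ℝ × ℝ → ℝ} (hφ : Continuous φ) ↦
    aemeasurable_of_continuous hY hreg hδ₀ hδ hT hφ
  exact (h continuous_fst).prodMk ((h (φ := fun p ↦ p.2.1) (by fun_prop)).prodMk
    ((h (φ := fun p ↦ p.2.2.1) (by fun_prop)).prodMk
      ((h (φ := fun p ↦ p.2.2.2.1) (by fun_prop)).prodMk
        (h (φ := fun p ↦ p.2.2.2.2) (by fun_prop)))))

/-- The weights `f ((j + 1) / k)` and their average over `j` give equal integrals on every grid. One
dominated convergence argument, `hlim`, handles both and produces the two sides. -/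
lemma lintegral_relPosition_mul [IsProbabilityMeasure P]
    (hY : IsLevyProcess (fun t ω ↦ (Y₁ t ω, Y₂ t ω)) P)
    (hreg : ∀ᵐ ω ∂P, IsRegularPath (Y₁ · ω) (Y₂ · ω)) (hδ₀ : ∀ n, 0 < δ n)
    (hδ : Tendsto δ atTop (𝓝 0)) (hT : ∀ᵐ ω ∂P, ∀ n (k : ℕ), firstAbove (Y₂ · ω) 1 ≠ k * δ n)
    (f : ℝ →ᵇ ℝ≥0) (g : ℝ × ℝ × ℝ × ℝ →ᵇ ℝ≥0) :
    ∫⁻ ω, (f (relPosition (Y₁ · ω) (Y₂ · ω)) : ℝ≥0∞) * g (passageData (Y₁ · ω) (Y₂ · ω)) ∂P =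
      ∫⁻ ω, (∫⁻ x in Set.Icc (0 : ℝ) 1, f x) * g (passageData (Y₁ · ω) (Y₂ · ω)) ∂P := by
  set D : ℕ → Ω → ℕ → ℝ × ℝ := fun n ω ↦ gridIncr (fun t ↦ (Y₁ t ω, Y₂ t ω)) (δ n) with hD
  have hDm : ∀ n, Measurable (D n) := fun n ↦
    measurable_pi_lambda _ fun j ↦ hY.measurable_gridIncr (δ n) j
  set w : ℕ → ℕ → ℝ≥0∞ := fun k j ↦ f (((j + 1 : ℕ) : ℝ) / k) with hw
  have hgm : Measurable fun p ↦ (g p : ℝ≥0∞) := g.continuous.measurable.coe_nnreal_ennreal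
  have hlim : ∀ (v : ℕ → ℕ → ℝ≥0∞) (l : Ω → ℝ≥0∞),
      (∀ k j, j < k → v k j ≤ nndist 0 f) →
      (∀ ω, ∀ k j : ℕ → ℕ, Tendsto k atTop atTop →
        Tendsto (fun n ↦ ((j n + 1 : ℕ) : ℝ) / k n) atTop (𝓝 (relPosition (Y₁ · ω) (Y₂ · ω))) →
        Tendsto (fun n ↦ v (k n) (j n)) atTop (𝓝 (l ω))) →
      (∀ ω, l ω ≠ ⊤) →
      Tendsto (fun n ↦ ∫⁻ ω, atCrossingMax (fun k j d ↦ v k j * g (crossingData k j d)) (D n ω) ∂P)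
        atTop (𝓝 (∫⁻ ω, l ω * g (passageData (Y₁ · ω) (Y₂ · ω)) ∂P)) := by
    intro v l hv hvl hl
    refine tendsto_lintegral_of_dominated_convergence
      (fun _ ↦ (nndist 0 f : ℝ≥0∞) * (nndist 0 g : ℝ≥0∞)) (fun n ↦ ?_) (fun n ↦ ?_) ?_ ?_
    · exact (measurable_atCrossingMax fun k j ↦
        (hgm.comp (measurable_crossingData k j)).const_mul _).comp (hDm n)
    · filter_upwards [hreg] with ω hω
      exact atCrossingMax_le (hω.gridIncr_snd_nonneg _) fun k j hjk ↦
        mul_le_mul' (hv k j hjk) (ENNReal.coe_le_coe.2 (g.apply_le_nndist_zero _))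
    · rw [lintegral_const, measure_univ, mul_one]
      exact ENNReal.mul_ne_top ENNReal.coe_ne_top ENNReal.coe_ne_top
    · filter_upwards [hreg, hT] with ω hω hTω
      obtain ⟨k, j, h1, h2, h3, h4⟩ := hω.exists_approx hδ₀ hδ hTω
      have hg : Tendsto (fun n ↦ (g (crossingData (k n) (j n) (D n ω)) : ℝ≥0∞)) atTop
          (𝓝 (g (passageData (Y₁ · ω) (Y₂ · ω)))) :=
        ENNReal.tendsto_coe.2 ((g.continuous.tendsto _).comp h4)
      refine (ENNReal.Tendsto.mul (hvl ω k j h2 h3) (Or.inr ENNReal.coe_ne_top) hg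
        (Or.inr (hl ω))).congr' ?_
      filter_upwards [h1] with n hn
      rw [atCrossingMax_eq (hω.gridIncr_snd_nonneg _) hn]
  have hwle : ∀ k j, w k j ≤ nndist 0 f := fun k j ↦
    ENNReal.coe_le_coe.2 (f.apply_le_nndist_zero _)
  have hL := hlim w (fun ω ↦ f (relPosition (Y₁ · ω) (Y₂ · ω))) (fun k j _ ↦ hwle k j)
    (fun ω k j _ h ↦ ENNReal.tendsto_coe.2 ((f.continuous.tendsto _).comp h))
    (fun ω ↦ ENNReal.coe_ne_top)
  have hfin : ∫⁻ x in Set.Icc (0 : ℝ) 1, (f x : ℝ≥0∞) ≠ ⊤ :=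
    ((lintegral_mono fun x ↦ ENNReal.coe_le_coe.2 (f.apply_le_nndist_zero x)).trans_lt
      (by simp [-coe_nnreal_ennreal_nndist])).ne
  have hR := hlim (fun k _ ↦ (∑ i ∈ Finset.range k, w k i) / k)
    (fun _ ↦ ∫⁻ x in Set.Icc (0 : ℝ) 1, f x)
    (fun k j hjk ↦ by
      refine ENNReal.div_le_of_le_mul ?_
      calc ∑ i ∈ Finset.range k, w k i ≤ ∑ i ∈ Finset.range k, (nndist 0 f : ℝ≥0∞) :=
            Finset.sum_le_sum fun i _ ↦ hwle k i
        _ = _ := by rw [Finset.sum_const, Finset.card_range, nsmul_eq_mul, mul_comm])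
    (fun ω k j hk _ ↦ (tendsto_average_lintegral f).comp hk) (fun _ ↦ hfin)
  refine tendsto_nhds_unique hL (hR.congr fun n ↦ ?_)
  have hQ := measurePreserving_swap_of_iid (P := P) (D := fun j ω ↦ D n ω j)
    (fun j ↦ hY.measurable_gridIncr (δ n) j) (hY.iIndepFun_gridIncr (δ n))
    (fun j ↦ ((hY.identDistrib_gridIncr (δ n) j).trans
      (hY.identDistrib_gridIncr (δ n) 0).symm).map_eq)
  have h := lintegral_atCrossingMax_eq_average hQ w hgm
  have hcm : ∀ v : ℕ → ℕ → ℝ≥0∞,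
      Measurable (atCrossingMax fun k j d ↦ v k j * (g (crossingData k j d) : ℝ≥0∞)) := fun v ↦
    measurable_atCrossingMax fun k j ↦ (hgm.comp (measurable_crossingData k j)).const_mul _
  rw [lintegral_map (hcm w) (hDm n),
    lintegral_map (hcm fun k _ ↦ (∑ i ∈ Finset.range k, w k i) / k) (hDm n)] at h
  exact h.symm

/-- The relative position of the largest jump is uniform and independent of the passage data. -/
theorem map_relPosition_prodMk_passageData [IsProbabilityMeasure P]
    (hY : IsLevyProcess (fun t ω ↦ (Y₁ t ω, Y₂ t ω)) P)
    (hreg : ∀ᵐ ω ∂P, IsRegularPath (Y₁ · ω) (Y₂ · ω)) (hδ₀ : ∀ n, 0 < δ n)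
    (hδ : Tendsto δ atTop (𝓝 0))
    (hT : ∀ᵐ ω ∂P, ∀ n (k : ℕ), firstAbove (Y₂ · ω) 1 ≠ k * δ n) :
    P.map (fun ω ↦ (relPosition (Y₁ · ω) (Y₂ · ω), passageData (Y₁ · ω) (Y₂ · ω))) =
      (volume.restrict (Set.Icc (0 : ℝ) 1)).prod (P.map fun ω ↦ passageData (Y₁ · ω) (Y₂ · ω)) := by
  have hm := aemeasurable_prodMk_passage hY hreg hδ₀ hδ hT
  have hV : AEMeasurable (fun ω ↦ passageData (Y₁ · ω) (Y₂ · ω)) P := hm.snd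
  have : IsFiniteMeasure (P.map (fun ω ↦ (relPosition (Y₁ · ω) (Y₂ · ω),
      passageData (Y₁ · ω) (Y₂ · ω)))) := Measure.isFiniteMeasure_map _ _
  have : IsFiniteMeasure (P.map fun ω ↦ passageData (Y₁ · ω) (Y₂ · ω)) :=
    Measure.isFiniteMeasure_map _ _
  refine ext_of_lintegral_mul_boundedContinuousFunction fun f g ↦ ?_
  have hf : Measurable fun x ↦ (f x : ℝ≥0∞) := f.continuous.measurable.coe_nnreal_ennreal
  have hg : Measurable fun x ↦ (g x : ℝ≥0∞) := g.continuous.measurable.coe_nnreal_ennreal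
  have hfg : Measurable fun p : ℝ × ℝ × ℝ × ℝ × ℝ ↦ (f p.1 : ℝ≥0∞) * g p.2 :=
    (hf.comp measurable_fst).mul (hg.comp measurable_snd)
  rw [lintegral_map' hfg.aemeasurable hm,
    lintegral_prod_mul hf.aemeasurable hg.aemeasurable, lintegral_map' hg.aemeasurable hV]
  exact (lintegral_relPosition_mul hY hreg hδ₀ hδ hT f g).trans
    (lintegral_const_mul'' _ (hg.comp_aemeasurable hV))

end Limit

end Position

/-- The explicit tail of the first marginal gives immediate and pairwise distinct jumps of `Y₁`. For
`Y₂` it suffices that its Lévy measure is nonzero, which holds because `ν` is nonzero and carried by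
the open quadrant. -/
lemma IsStableMeasure.ae_isRegularPath {κ C : ℝ} (hκ : 0 < κ) (hC : 0 < C)
    {Ω' : Type*} [MeasurableSpace Ω'] {P' : Measure Ω'} [IsProbabilityMeasure P'] {R : Ω' → ℝ≥0∞}
    (hR : Measurable R) (hR0 : ∀ ω, 0 < R ω) {ν : Measure (ℝ × ℝ)}
    (hν : IsStableMeasure κ C R P' ν)
    {Ω : Type*} [MeasurableSpace Ω] {P : Measure Ω} [IsProbabilityMeasure P]
    {Y₁ Y₂ : ℝ≥0 → Ω → ℝ} (hY : IsLevyProcess (fun t ω ↦ (Y₁ t ω, Y₂ t ω)) P)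
    (hnn : ∀ᵐ ω ∂P, ∀ t, 0 ≤ Y₁ t ω ∧ 0 ≤ Y₂ t ω)
    (hY_meas : IsLevyMeasure ν (fun t ω ↦ (Y₁ t ω, Y₂ t ω)) P) :
    ∀ᵐ ω ∂P, IsRegularPath (Y₁ · ω) (Y₂ · ω) := by
  have hY₁ : IsLevyProcess Y₁ P := hY.fst
  have hY₂ : IsLevyProcess Y₂ P := hY.snd
  have hnn₁ : ∀ᵐ ω ∂P, ∀ t, 0 ≤ Y₁ t ω := hnn.mono fun ω h t ↦ (h t).1
  have hnn₂ : ∀ᵐ ω ∂P, ∀ t, 0 ≤ Y₂ t ω := hnn.mono fun ω h t ↦ (h t).2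
  have hμ₁ : IsLevyMeasure (ν.map Prod.fst) Y₁ P := hY_meas.map_fst hY
  have hμ₂ : IsLevyMeasure (ν.map Prod.snd) Y₂ P := hY_meas.map_snd hY
  have htail : ∀ x > 0, ν.map Prod.fst (Set.Ici x) = ENNReal.ofReal (C / x ^ κ) := fun x hx ↦ by
    rw [Measure.map_apply measurable_fst measurableSet_Ici, ← hν.marginal hκ hC hR hR0 hx,
      Set.prod_univ]
  have htop : ∀ L : ℝ≥0, ∃ x > 0, (L : ℝ≥0∞) < ν.map Prod.fst (Set.Ici x) := fun L ↦ by
    have hL : (0 : ℝ) < L + 1 := by positivity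
    refine ⟨tailQuantile κ C (L + 1), tailQuantile_pos hC hL, ?_⟩
    rw [htail _ (tailQuantile_pos hC hL), tailQuantile_rpow hκ hC hL, div_div_cancel₀ hC.ne',
      ← ENNReal.ofReal_coe_nnreal]
    exact (ENNReal.ofReal_lt_ofReal_iff hL).2 (by linarith)
  have hne : ν.map Prod.snd (Set.Ioi 0) ≠ 0 := by
    rw [Measure.map_apply measurable_snd measurableSet_Ioi]
    intro h0
    have h1 : ν (Set.Ici 1 ×ˢ Set.univ) = 0 :=
      measure_mono_null (t := Prod.snd ⁻¹' Set.Ioi 0 ∪ (Set.Ioi 0 ×ˢ Set.Ioi 0)ᶜ)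
        (fun p _ ↦ by
          by_cases hp : 0 < p.2
          · exact Or.inl hp
          · exact Or.inr fun h ↦ hp h.2)
        (measure_union_null h0 hν.compl)
    rw [hν.marginal hκ hC hR hR0 one_pos, Real.one_rpow, div_one, ENNReal.ofReal_eq_zero] at h1
    linarith
  filter_upwards [hY₁.ae_monotone hnn₁, hY₂.ae_monotone hnn₂, hY₂.zero,
    hY₂.ae_exists_one_lt hnn₂ (hμ₂.measure_pos_ne_zero hY₂ hnn₂ hne),
    hμ₁.ae_exists_jump hY₁ hnn₁ htop,
    hμ₁.ae_jump_injective hY₁ hnn₁ hκ hC htail] with ω h1 h2 h3 h4 h5 h6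
  exact ⟨h1, h2, fun s ↦ (hY₁.cadlag ω s).1, fun s ↦ (hY₂.cadlag ω s).1, h3, h4, h5, h6⟩

end StableJump

end

/-! ### The uniform law and the independence. -/

theorem lemma5p5 {κ C : ℝ} (hκ₀ : 0 < κ) (hκ₁ : κ < 1) (hC : 0 < C)
    {Ω' : Type*} [MeasurableSpace Ω'] (P' : Measure Ω') [IsProbabilityMeasure P']
    (W W' : ℝ≥0 → Ω' → ℝ)
    (hW : StableJump.IsConditionedBM κ W P') (hW' : StableJump.IsConditionedBM κ W' P')
    (hind : IndepFun (fun ω t ↦ W t ω) (fun ω t ↦ W' t ω) P')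
    (ν : Measure (ℝ × ℝ))
    (hν : StableJump.IsStableMeasure κ C (StableJump.expFunctional W W') P' ν)
    {Ω : Type*} [MeasurableSpace Ω] (P : Measure Ω) [IsProbabilityMeasure P]
    (Y₁ Y₂ : ℝ≥0 → Ω → ℝ)
    (hY : StableJump.IsLevyProcess (fun t ω ↦ (Y₁ t ω, Y₂ t ω)) P)
    (hY_nonneg : ∀ᵐ ω ∂P, ∀ t, 0 ≤ Y₁ t ω ∧ 0 ≤ Y₂ t ω)
    (hY_jump : StableJump.IsPureJump (fun t ω ↦ (Y₁ t ω, Y₂ t ω)) P)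
    (hY_meas : StableJump.IsLevyMeasure ν (fun t ω ↦ (Y₁ t ω, Y₂ t ω)) P) :
    pdf.IsUniform
      (fun ω ↦ (StableJump.Fstar (Y₁ · ω) (Y₂ · ω) : ℝ) / StableJump.firstAbove (Y₂ · ω) 1)
      (Set.Icc (0 : ℝ) 1) P volume ∧
    AEMeasurable
      (fun ω ↦ (StableJump.I₁ (Y₁ · ω) (Y₂ · ω), StableJump.I₂ (Y₁ · ω) (Y₂ · ω))) P ∧
    IndepFun
      (fun ω ↦ (StableJump.Fstar (Y₁ · ω) (Y₂ · ω) : ℝ) / StableJump.firstAbove (Y₂ · ω) 1)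
      (fun ω ↦ (StableJump.I₁ (Y₁ · ω) (Y₂ · ω), StableJump.I₂ (Y₁ · ω) (Y₂ · ω))) P := by
  have hR : Measurable (StableJump.expFunctional W W') :=
    (StableJump.measurable_lintegral_exp_neg hW.measurable hW.continuous).add
      (StableJump.measurable_lintegral_exp_neg hW'.measurable hW'.continuous)
  have hR0 : ∀ ω, 0 < StableJump.expFunctional W W' ω := fun ω ↦
    add_pos_of_pos_of_nonneg (StableJump.lintegral_exp_neg_pos (hW.continuous ω)) zero_le
  have hreg := hν.ae_isRegularPath hκ₀ hC hR hR0 hY hY_nonneg hY_meas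
  obtain ⟨δ, hδ₀, hδ, hT⟩ := StableJump.exists_grid_avoiding
    (StableJump.aemeasurable_firstAbove (fun t ↦ (hY.measurable t).snd) hreg)
    (hreg.mono fun ω h ↦ h.firstAbove_pos)
  have hm := StableJump.aemeasurable_prodMk_passage hY hreg hδ₀ hδ hT
  have hU : AEMeasurable (fun ω ↦ StableJump.relPosition (Y₁ · ω) (Y₂ · ω)) P := hm.fst
  have hV : AEMeasurable (fun ω ↦ StableJump.passageData (Y₁ · ω) (Y₂ · ω)) P := hm.snd
  have hlaw := StableJump.map_relPosition_prodMk_passageData hY hreg hδ₀ hδ hT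
  have : IsProbabilityMeasure (P.map fun ω ↦ StableJump.passageData (Y₁ · ω) (Y₂ · ω)) :=
    Measure.isProbabilityMeasure_map hV
  have hUlaw : P.map (fun ω ↦ StableJump.relPosition (Y₁ · ω) (Y₂ · ω)) =
      volume.restrict (Set.Icc (0 : ℝ) 1) := by
    have h := congrArg (Measure.map Prod.fst) hlaw
    rw [AEMeasurable.map_map_of_aemeasurable measurable_fst.aemeasurable hm, Measure.map_fst_prod,
      measure_univ, one_smul] at h
    exact h
  -- The quotient in `I₂` is measurable but not continuous, so it is applied after the limit, to the
  -- passage data whose joint law is already known.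
  have hψ : Measurable fun p : ℝ × ℝ × ℝ × ℝ ↦ (p.1, (1 - p.2.1) * (p.2.2.1 / p.2.2.2)) := by
    fun_prop
  refine ⟨?_, hψ.comp_aemeasurable hV, ?_⟩
  · rw [pdf.IsUniform, ProbabilityTheory.cond]
    simpa [StableJump.relPosition] using hUlaw
  · have hind : IndepFun (fun ω ↦ StableJump.relPosition (Y₁ · ω) (Y₂ · ω))
        (fun ω ↦ StableJump.passageData (Y₁ · ω) (Y₂ · ω)) P :=
      (indepFun_iff_map_prod_eq_prod_map_map hU hV).2 (by rw [hlaw, hUlaw])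
    exact hind.comp measurable_id hψ
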